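/- **Conventions.** A permutation $w\in S_n$ is written as a word $w_1w_2\cdots w_n$ in which each of $1,\dots,n$ appears exactly once. Its *cocharge word* $\mathrm{cc}(w)$ is obtained by replacing each letter of $w$ by a label: the letter $1$ has label $0$, and if $i$ has label $k$, then $i+1$ has label $k$ if it stands to the right of $i$ in $w$, and label $k+1$ if it stands to the left of $i$. A word $x$ is a *shuffle* of words $z^{(1)},\dots,z^{(l)}$, written $x\in\mathrm{Sh}(z^{(1)},\dots,z^{(l)})$, if the positions of $x$ can be partitioned into $l$ (possibly empty) sets such that the subword of $x$ on the $j$-th set is $z^{(j)}$ for every $j$. Let $P(v)$ be the Schensted (RSK) insertion tableau of a word $v$ with distinct letters. If $T$ is a tableau with first row $r$, and $v$ is the word obtained by concatenating its other rows from the last one to the second one (so that $T=P(vr)$), the *catabolism* of $T$ is $K(T)=P(rv)$. Let $d(T)$ be the largest $m$ such that the first row of $T$ contains $1,2,\dots,m$. The *catabolizability type* of a standard Young tableau $T$ is the sequence $$\mathrm{ctype}(T)=\bigl(d(T),\ d(K(T))-d(T),\ d(K^2(T))-d(K(T)),\ \dots\bigr),$$ and $\mathrm{ctype}(w)=\mathrm{ctype}(P(w))$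 for a permutation $w$. For $w \in S_n$ this sequence is, up to trailing zeros, a partition of $n$. For partitions $\mu,\lambda$ of $n$, the dominance order is given by $\mu\trianglerighteq\lambda$ if and only if $\mu_1+\cdots+\mu_k\ge\lambda_1+\cdots+\lambda_k$ for all $k$. **Theorem.** Let $u^{(1)},\dots,u^{(l)},w$ be permutations (of possibly different sizes), with $w\in S_n$, such that $$\mathrm{cc}(w)\in\mathrm{Sh}\bigl(\mathrm{cc}(u^{(1)}),\dots,\mathrm{cc}(u^{(l)})\bigr).$$ Then, as partitions of $n$, $$\mathrm{ctype}(w)\ \trianglerighteq\ \mathrm{ctype}(u^{(1)})+\cdots+\mathrm{ctype}(u^{(l)}),$$ where the right-hand side is the partwise sum of the partitions. -/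

import Mathlib

namespace Catabolism

/-- The one-line word `w₁ w₂ … wₙ` of a permutation, with letters `1, …, n`. -/
def oneLine {n : ℕ} (w : Equiv.Perm (Fin n)) : List ℕ :=
  List.ofFn fun i => (w i : ℕ) + 1

/-! ### Cocharge words and shuffles -/

/-- The cocharge label of the letter `i` in the word `w`: the letter `1` has label `0`, and `i + 1`
has the label of `i` if it stands to the right of `i` in `w`, and that label plus one if it stands
to the left of `i`. (The value at `0`, which is not a letter, is irrelevant.) -/
def cochargeLabel (w : List ℕ) : ℕ → ℕ
  | 0 => 0
  | 1 => 0
  | i + 2 => cochargeLabel w (i + 1) + if w.idxOf (i + 2) < w.idxOf (i + 1) then 1 else 0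

/-- The cocharge word `cc(w)`: every letter of `w` is replaced by its label. -/
def cc {n : ℕ} (w : Equiv.Perm (Fin n)) : List ℕ :=
  (oneLine w).map (cochargeLabel (oneLine w))

/-- `IsShuffle z x` says that `x ∈ Sh(z 0, …, z (l - 1))`: the letters of `x` can be coloured by
`Fin l` so that, for every `j`, the subword of the letters of colour `j` is `z j`. -/
def IsShuffle {l : ℕ} (z : Fin l → List ℕ) (x : List ℕ) : Prop :=
  ∃ p : List (Fin l × ℕ), p.map Prod.snd = x ∧
    ∀ j, (p.filter fun a => a.1 = j).map Prod.snd = z j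

/-! ### Insertion tableaux -/

/-- Schensted insertion of `x` into a row: `x` replaces the leftmost entry that is larger than `x`,
and this entry is the second component of the result; if there is none, then `x` is appended at the
end and the second component is `none`. -/
def rowInsert (x : ℕ) : List ℕ → List ℕ × Option ℕ
  | [] => ([x], none)
  | y :: r => if x < y then (x :: r, some y) else (y :: (rowInsert x r).1, (rowInsert x r).2)

/-- Schensted insertion of `x` into a tableau, given by the list of its rows, first row first
(that is, from bottom to top in French notation): a bumped entry goes into the next row. -/
def tabInsert (x : ℕ) : List (List ℕ) → List (List ℕ)
  | [] => [[x]]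
  | r :: T =>
    match rowInsert x r with
    | (r', none) => r' :: T
    | (r', some y) => r' :: tabInsert y T

/-- The insertion tableau `P(w)` of a word: its letters are inserted from left to right. -/
def P (w : List ℕ) : List (List ℕ) :=
  w.foldl (fun T x => tabInsert x T) []

/-- The first row of a tableau. -/
def firstRow (T : List (List ℕ)) : List ℕ := T.headD []

/-- The reading word of the tableau that consists of the rows above the first row:
the rows are concatenated from the last one (the top) down to the second one. -/
def upperWord (T : List (List ℕ)) : List ℕ := T.tail.reverse.flatten

/-! ### Catabolism -/

/-- Catabolism. The reading word of `T` is `upperWord T ++ firstRow T`, and `K(T)` is the insertion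
tableau of the word in which the two factors are exchanged. -/
def K (T : List (List ℕ)) : List (List ℕ) := P (firstRow T ++ upperWord T)

/-- `d(T)`: the largest `m` such that the first row of `T` contains `1, 2, …, m`.
(Such an `m` is at most the length of the row.) -/
def d (T : List (List ℕ)) : ℕ :=
  Nat.findGreatest (fun m => ∀ i < m, i + 1 ∈ firstRow T) (firstRow T).length

/-- The catabolizability type of a tableau, as a sequence indexed from `0`:
`d(T), d(K(T)) - d(T), d(K²(T)) - d(K(T)), …`.
The entries `1, …, d(T)` stay in the first row under `K`, so no subtraction truncates. -/
def ctypeTab (T : List (List ℕ)) : ℕ → ℕ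
  | 0 => d T
  | i + 1 => d (K^[i + 1] T) - d (K^[i] T)

/-- `ctype(w) = ctype(P(w))`. -/
def ctype {n : ℕ} (w : Equiv.Perm (Fin n)) : ℕ → ℕ := ctypeTab (P (oneLine w))

/-! ### Partitions and dominance -/

/-- The sequence `μ`, indexed from `0`, is a partition of `n` followed by zeros. -/
def IsPartitionOf (n : ℕ) (μ : ℕ → ℕ) : Prop :=
  Antitone μ ∧ ∃ N, (∀ i, N ≤ i → μ i = 0) ∧ ∑ i ∈ Finset.range N, μ i = n

/-- `μ ⊵ ν` in the dominance order on the set of partitions of `n`. -/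
def Dominates (n : ℕ) (μ ν : ℕ → ℕ) : Prop :=
  IsPartitionOf n μ ∧ IsPartitionOf n ν ∧
    ∀ k, ∑ i ∈ Finset.range k, ν i ≤ ∑ i ∈ Finset.range k, μ i

end Catabolism

/-!
The catabolizability type of a permutation is computed by *catabolism insertion* (`Eval`), which
reads the cocharge word from right to left. A label `e` adds a box to row `e` of a growing shape
(rows indexed from `0`) if the result is a shape; otherwise it goes back to the end of the queue
as `e + 1`. That the final shape is `ctype w` is `outcome_ctype`, for two reasons.

* The final shape does not change under Knuth relations. On labels these become the relations
  `ShortMove`, and when such a relation reaches the head of the queue, either both sides lead to the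
  same state or all labels are rejected and the relation reappears, one higher, at the end
  (`eval_iff_of_queueMove`, `Knuth.eval_iff`). Hence a word can be replaced by the reading word of
  its insertion tableau (`P_spec`).
* For the reading word `v r` of a tableau, passing to `r v` decreases the labels of `v` by one
  (`cochargeLabel_rotate`), and merges the first two rows of the final shape, the first of which
  has length `d(T)` (`outcome_rotate`, `outcome_K`). Column strictness enters here: it guarantees
  that the labels `1` of `v` all fit into the second row.

The dominance inequality is an optimality property of catabolism insertion. Let a label of the
queue be visited every `N` time units, and attach to it the integer `T - N * e`, its *anchor*,
where `T` is the time of a visit and `e` the label at that time; the anchor never changes. Growing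
one column of the shape by successive boxes amounts to listing a set of anchors in an order without
descents of size `≥ N`, and such an order exists exactly if the set is `Covered`. Therefore the
columns of the final shape divide the anchors into covered sets (`exists_chains`). Conversely, for
any division of the anchors into covered sets, the final shape dominates the shape with columns of
these sizes (`sum_min_le`). Indeed, whenever insertion puts a label into another column than
the division asks for, the two columns concerned can be given other covered sets that agree with the
insertion and whose sizes are at least as balanced; this is the exchange lemma `exchange`, whose
main point is the crossing argument `uncross` for two descending chains.

Being covered only depends on the set, not on the remaining word. So, for a shuffle, the covered
sets that come from the cocharge words of all the `u j`, taken with the visiting times they have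
inside the shuffle, form a division of the anchors of `cc w`. The columns of these shapes together
are the columns of the partwise sum of the types, whence the claim.
-/

namespace Catabolism

/-! ### Chains of integers -/

/-- A finite set `S` of integers is *covered below* `s` with step `N` if every element of `S`
that is less than `s` has a larger element of `S` at distance less than `N`. Equivalently, `S` can
be listed in an order that begins with an element `≥ s` and in which no descent is as large
as `N`. -/
def Covered (N : ℤ) (S : Finset ℤ) (s : ℤ) : Prop :=
  ∀ y ∈ S, y < s → ∃ z ∈ S, y < z ∧ z < y + N

theorem Covered.mono {N : ℤ} {S : Finset ℤ} {s s' : ℤ} (h : Covered N S s) (hs : s' ≤ s) :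
    Covered N S s' := fun y hy hlt => h y hy (lt_of_lt_of_le hlt hs)

/-- An integer that is not in `S`, but lies above an element of `S`, is covered as well. -/
theorem Covered.exists_cover {N : ℤ} {S : Finset ℤ} {s w f : ℤ} (h : Covered N S s) (hw : w ∈ S)
    (hwf : w < f) (hf : f ∉ S) (hfs : f < s) : ∃ z ∈ S, f < z ∧ z < f + N := by
  have hne : (S.filter (· < f)).Nonempty := ⟨w, by simp [hw, hwf]⟩
  obtain ⟨u, hu, hmax⟩ := (S.filter (· < f)).exists_max_image id hne
  simp only [Finset.mem_filter, id] at hu hmax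
  obtain ⟨z, hz, h1, h2⟩ := h u hu.1 (hu.2.trans hfs)
  refine ⟨z, hz, ?_, by linarith [hu.2]⟩
  rcases lt_trichotomy z f with h3 | h3 | h3
  · exact absurd (hmax z ⟨hz, h3⟩) (not_le.2 h1)
  · exact absurd (h3 ▸ hz) hf
  · exact h3

theorem Covered.insert_of {N : ℤ} {S : Finset ℤ} {s f : ℤ} (h : Covered N S s)
    (hf : s ≤ f ∨ ∃ w ∈ S, w < f) : Covered N (insert f S) s := by
  by_cases hfS : f ∈ S
  · rwa [Finset.insert_eq_of_mem hfS]
  intro y hy hys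
  rcases Finset.mem_insert.1 hy with rfl | hy
  · rcases hf with hf | ⟨w, hw, hwf⟩
    · exact absurd hys (not_lt.2 hf)
    · obtain ⟨z, hz, h'⟩ := h.exists_cover hw hwf hfS hys
      exact ⟨z, Finset.mem_insert_of_mem hz, h'⟩
  · obtain ⟨z, hz, h'⟩ := h y hy hys
    exact ⟨z, Finset.mem_insert_of_mem hz, h'⟩

theorem Covered.erase_min {N : ℤ} {S : Finset ℤ} {s x : ℤ} (h : Covered N S s)
    (hx : ∀ y ∈ S, x ≤ y) : Covered N (S.erase x) s := by
  intro y hy hys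
  obtain ⟨hyx, hy⟩ := Finset.mem_erase.1 hy
  obtain ⟨z, hz, h1, h2⟩ := h y hy hys
  exact ⟨z, Finset.mem_erase.2 ⟨by have := hx y hy; omega, hz⟩, h1, h2⟩

/-- The smallest elements of `B` can be handed over to `A` one at a time, if every element of `B`
reaches the threshold of `A` or lies above some element of `A`. -/
theorem Covered.transfer {N s₁ s₂ : ℤ} : ∀ (k : ℕ) (A B : Finset ℤ), Disjoint A B →
    Covered N A s₁ → Covered N B s₂ → (∀ y ∈ B, s₁ ≤ y ∨ ∃ x ∈ A, x < y) → k ≤ B.card →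
    ∃ A' B' : Finset ℤ, Disjoint A' B' ∧ A' ∪ B' = A ∪ B ∧ Covered N A' s₁ ∧ Covered N B' s₂ ∧
      A'.card = A.card + k
  | 0, A, B, hd, hA, hB, _, _ => ⟨A, B, hd, rfl, hA, hB, rfl⟩
  | k + 1, A, B, hd, hA, hB, hAB, hk => by
    have hne : B.Nonempty := Finset.card_pos.1 (by omega)
    obtain ⟨x, hx, hmin⟩ := B.exists_min_image id hne
    have hxA : x ∉ A := fun h => Finset.disjoint_left.1 hd h hx
    obtain ⟨A', B', h1, h2, h3, h4, h5⟩ := Covered.transfer (s₁ := s₁) (s₂ := s₂) k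
      (insert x A) (B.erase x)
      (by
        rw [Finset.disjoint_insert_left]
        exact ⟨Finset.notMem_erase _ _, hd.mono_right (Finset.erase_subset _ _)⟩)
      (hA.insert_of (hAB x hx)) (hB.erase_min hmin)
      (fun y hy => by
        rcases hAB y (Finset.mem_of_mem_erase hy) with h | ⟨z, hz, h⟩
        · exact Or.inl h
        · exact Or.inr ⟨z, Finset.mem_insert_of_mem hz, h⟩)
      (by rw [Finset.card_erase_of_mem hx]; omega)
    refine ⟨A', B', h1, ?_, h3, h4, ?_⟩
    · rw [h2, Finset.insert_union, ← Finset.union_insert, Finset.insert_erase hx]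
    · rw [h5, Finset.card_insert_of_notMem hxA]; ring

theorem Covered.card_above {N s : ℤ} {S : Finset ℤ} (h : Covered N S s) (hN : 0 < N) :
    ∀ (k : ℕ) (y : ℤ), y ∈ S → y + N * k ≤ s → k ≤ (S.filter (y < ·)).card
  | 0, _, _, _ => Nat.zero_le _
  | k + 1, y, hy, hs => by
    push_cast at hs
    have hk : 0 ≤ N * k := by positivity
    obtain ⟨z, hz, h1, h2⟩ := h y hy (by nlinarith)
    have ih := Covered.card_above h hN k z hz (by nlinarith)
    have hsub : insert z (S.filter (z < ·)) ⊆ S.filter (y < ·) := by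
      intro u hu
      simp only [Finset.mem_insert, Finset.mem_filter] at hu ⊢
      rcases hu with rfl | ⟨hu, hzu⟩
      · exact ⟨hz, h1⟩
      · exact ⟨hu, h1.trans hzu⟩
    have := Finset.card_le_card hsub
    rw [Finset.card_insert_of_notMem (by simp)] at this
    omega

/-- `x, y` are consecutive in a descending chain with steps less than `N`. -/
abbrev Descent (N : ℤ) (x y : ℤ) : Prop := y < x ∧ x < y + N

theorem exists_cover_of_isChain {N : ℤ} : ∀ {l : List ℤ} {β : ℤ}, (β :: l).IsChain (Descent N) →
    ∀ y ∈ l, ∃ z ∈ β :: l, y < z ∧ z < y + N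
  | [], _, _, y, hy => by simp at hy
  | a :: l, β, h, y, hy => by
    rw [List.isChain_cons_cons] at h
    rcases List.mem_cons.1 hy with rfl | hy
    · exact ⟨β, by simp, h.1⟩
    · obtain ⟨z, hz, h'⟩ := exists_cover_of_isChain h.2 y hy
      exact ⟨z, List.mem_cons_of_mem _ hz, h'⟩

theorem lt_of_isChain {N : ℤ} : ∀ {l : List ℤ} {β : ℤ}, (β :: l).IsChain (Descent N) →
    ∀ y ∈ l, y < β
  | [], _, _, y, hy => by simp at hy
  | a :: l, β, h, y, hy => by
    rw [List.isChain_cons_cons] at h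
    rcases List.mem_cons.1 hy with rfl | hy
    · exact h.1.1
    · exact (lt_of_isChain h.2 y hy).trans h.1.1

/-- The crossing argument. Two descending chains `A` (below `α`) and `B` (below `β`) with
`β < α` are recombined so that the chain below `β` contains the least element of all
and is not longer than `A`. The chains are exchanged as long as they interlace, and
they can be uncrossed as soon as they do not. -/
theorem uncross {N : ℤ} : ∀ (A B : List ℤ) (α β : ℤ), (α :: A).IsChain (Descent N) →
    (β :: B).IsChain (Descent N) → β < α → (∀ a ∈ A, a < β) → (∃ a ∈ A, ∀ b ∈ B, a < b) →
    ∃ A' B' : List ℤ, (A' ++ B').Perm (A ++ B) ∧ (α :: A').IsChain (Descent N) ∧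
      (β :: B').IsChain (Descent N) ∧ B'.length ≤ A.length ∧ ∃ x ∈ B', ∀ y ∈ A', x < y
  | [], _, _, _, _, _, _, _, hmin => by simp at hmin
  | a :: A, [], α, β, hA, _, hβα, hAβ, _ => by
    rw [List.isChain_cons_cons] at hA
    have := hAβ a (by simp)
    refine ⟨[], a :: A, by simp, by simp, ?_, le_rfl, a, by simp, by simp⟩
    rw [List.isChain_cons_cons]
    exact ⟨⟨this, by have := hA.1.2; omega⟩, hA.2⟩
  | a :: A, b :: B, α, β, hA, hB, hβα, hAβ, hmin => by
    obtain ⟨m, hmA, hm⟩ := hmin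
    have hA' := hA
    have hB' := hB
    rw [List.isChain_cons_cons] at hA hB
    obtain ⟨⟨h1, h2⟩, h3⟩ := hA
    obtain ⟨⟨h4, h5⟩, h6⟩ := hB
    have haβ := hAβ a (by simp)
    by_cases hb : α < b + N
    · -- no crossing is needed
      refine ⟨b :: B, a :: A, List.perm_append_comm, ?_, ?_, le_rfl, m, hmA, hm⟩
      · rw [List.isChain_cons_cons]
        exact ⟨⟨by omega, hb⟩, h6⟩
      · rw [List.isChain_cons_cons]
        exact ⟨⟨haβ, by omega⟩, h3⟩
    · have hba : b < a := by omega
      have hma : m ∈ A := by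
        rcases List.mem_cons.1 hmA with rfl | h
        · have := hm b (by simp); omega
        · exact h
      match A, h3, hma, hA', hAβ with
      | a₂ :: A, h3, hma, hA', hAβ =>
        rw [List.isChain_cons_cons] at h3
        obtain ⟨⟨h7, h8⟩, h9⟩ := h3
        by_cases ha : β < a₂ + N
        · -- `a` moves over and covers `b`, and the rest of `A` needs no cover
          refine ⟨a :: b :: B, a₂ :: A, ?_, ?_, ?_, by simp, m, hma, ?_⟩
          · have h := (List.perm_append_comm (l₁ := b :: B) (l₂ := a₂ :: A)).cons a
            simpa using h
          · rw [List.isChain_cons_cons, List.isChain_cons_cons]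
            exact ⟨⟨h1, h2⟩, ⟨hba, by omega⟩, h6⟩
          · rw [List.isChain_cons_cons]
            exact ⟨⟨by omega, ha⟩, h9⟩
          · intro y hy
            rcases List.mem_cons.1 hy with rfl | hy
            · exact (hm b (by simp)).trans hba
            · exact hm y hy
        · -- the chains interlace: exchange `a` and `b`
          have hA₂ : (a :: a₂ :: A).IsChain (Descent N) := by
            rw [List.isChain_cons_cons]; exact ⟨⟨h7, h8⟩, h9⟩
          obtain ⟨A', B', hp, hcA, hcB, hlen, x, hx, hlt⟩ := uncross (a₂ :: A) B a b hA₂ h6 hba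
            (fun y hy => by
              rcases List.mem_cons.1 hy with rfl | hy
              · omega
              · have := lt_of_isChain h9 y hy; omega)
            ⟨m, hma, fun y hy => hm y (List.mem_cons_of_mem _ hy)⟩
          refine ⟨a :: A', b :: B', ?_, ?_, ?_, by simpa using hlen, x, by simp [hx], ?_⟩
          · have h1 : (a :: A' ++ b :: B').Perm (b :: a :: (A' ++ B')) := by
              rw [List.cons_append]
              exact ((List.perm_middle).cons a).trans (List.Perm.swap _ _ _)
            have h2 : (a :: a₂ :: A ++ b :: B).Perm (b :: a :: (a₂ :: A ++ B)) := by
              rw [List.cons_append]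
              exact ((List.perm_middle).cons a).trans (List.Perm.swap _ _ _)
            exact h1.trans (((hp.cons a).cons b).trans h2.symm)
          · rw [List.isChain_cons_cons]; exact ⟨⟨h1, h2⟩, hcA⟩
          · rw [List.isChain_cons_cons]; exact ⟨⟨h4, h5⟩, hcB⟩
          · intro y hy
            rcases List.mem_cons.1 hy with rfl | hy
            · have := lt_of_isChain hcB x hx; omega
            · exact hlt y hy

/-- The elements of a covered set below `β`, listed in decreasing order, form a chain. -/
theorem Covered.exists_chain {N : ℤ} : ∀ (n : ℕ) (S : Finset ℤ) (β : ℤ), S.card = n →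
    (∀ y ∈ S, y < β ∧ ∃ z ∈ insert β S, y < z ∧ z < y + N) →
    ∃ l : List ℤ, l.Nodup ∧ l.toFinset = S ∧ (β :: l).IsChain (Descent N)
  | 0, S, β, hc, _ => ⟨[], by simp, by simp [Finset.card_eq_zero.1 hc], by simp⟩
  | n + 1, S, β, hc, hS => by
    have hne : S.Nonempty := Finset.card_pos.1 (by omega)
    obtain ⟨x, hx, hmax⟩ := S.exists_max_image id hne
    simp only [id] at hmax
    obtain ⟨l, hl, hlS, hch⟩ := Covered.exists_chain (N := N) n (S.erase x) x
      (by rw [Finset.card_erase_of_mem hx, hc]; rfl)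
      (fun y hy => by
        obtain ⟨hyx, hy⟩ := Finset.mem_erase.1 hy
        have hlt : y < x := lt_of_le_of_ne (hmax y hy) hyx
        refine ⟨hlt, ?_⟩
        obtain ⟨hyβ, z, hz, h1, h2⟩ := hS y hy
        rcases Finset.mem_insert.1 hz with rfl | hz
        · exact ⟨x, by simp, hlt, by have := (hS x hx).1; omega⟩
        · refine ⟨z, ?_, h1, h2⟩
          rw [Finset.insert_erase hx]; exact hz)
    refine ⟨x :: l, ?_, ?_, ?_⟩
    · rw [List.nodup_cons]
      refine ⟨fun h => ?_, hl⟩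
      rw [← List.mem_toFinset, hlS] at h
      simp at h
    · rw [List.toFinset_cons, hlS, Finset.insert_erase hx]
    · rw [List.isChain_cons_cons]
      refine ⟨?_, hch⟩
      obtain ⟨hyβ, z, hz, h1, h2⟩ := hS x hx
      rcases Finset.mem_insert.1 hz with rfl | hz
      · exact ⟨hyβ, h2⟩
      · exact absurd (hmax z hz) (not_le.2 h1)

/-- A way of splitting `S₁ ∪ S₂` into two covered sets, of which the first is not too long and can
take over any element of the second, can be balanced by moving elements from the second set to the
first. -/
theorem exists_balanced {N s₁ s₂ : ℤ} {S₁ S₂ A B : Finset ℤ} {e h : ℕ} (hd : Disjoint S₁ S₂)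
    (hAB : Disjoint A B) (hu : A ∪ B = S₁ ∪ S₂) (hA : Covered N A s₁) (hB : Covered N B s₂)
    (hadd : ∀ y ∈ B, s₁ ≤ y ∨ ∃ x ∈ A, x < y)
    (hlen : e + 1 + A.card ≤ max (e + S₁.card) (h + 1 + S₂.card)) :
    ∃ A' B' : Finset ℤ, Disjoint A' B' ∧ A' ∪ B' = S₁ ∪ S₂ ∧ Covered N A' s₁ ∧ Covered N B' s₂ ∧
      ∀ m, min m (e + S₁.card) + min m (h + 1 + S₂.card) ≤
        min m (e + 1 + A'.card) + min m (h + B'.card) := by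
  have hcard : A.card + B.card = S₁.card + S₂.card := by
    rw [← Finset.card_union_of_disjoint hAB, hu, Finset.card_union_of_disjoint hd]
  obtain ⟨A', B', h1, h2, h3, h4, h5⟩ := Covered.transfer
    (min (e + S₁.card) (h + 1 + S₂.card) - (e + 1 + A.card)) A B hAB hA hB hadd (by omega)
  refine ⟨A', B', h1, h2.trans hu, h3, h4, fun m => ?_⟩
  have hcard' : A'.card + B'.card = S₁.card + S₂.card := by
    rw [← Finset.card_union_of_disjoint h1, h2, hu, Finset.card_union_of_disjoint hd]
  omega

/-- The exchange lemma. Consider two chains of heights `e` and `h ≠ e`, and let `y₀`, which belongs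
to the second one, be visited at level `e`. Then `y₀` can be given to the first chain,
provided that the remaining elements are suitably redistributed, and this can be done without
making the two lengths less balanced. -/
theorem exchange {N y₀ : ℤ} (hN : 0 < N) {S₁ S₂ : Finset ℤ} {e h : ℕ} (hne : e ≠ h)
    (hd : Disjoint S₁ S₂) (h₁ : y₀ ∉ S₁) (h₂ : y₀ ∉ S₂) (C₁ : Covered N S₁ y₀)
    (C₂ : Covered N (insert y₀ S₂) (y₀ + N * (e - h))) :
    ∃ A' B' : Finset ℤ, Disjoint A' B' ∧ A' ∪ B' = S₁ ∪ S₂ ∧ Covered N A' (y₀ + 1 - N) ∧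
      Covered N B' (y₀ + N * (e - h)) ∧
      ∀ m, min m (e + S₁.card) + min m (h + 1 + S₂.card) ≤
        min m (e + 1 + A'.card) + min m (h + B'.card) := by
  rcases lt_or_gt_of_ne hne with hlt | hgt
  · -- the removed element `y₀` covers nothing that needs a cover
    have hs : y₀ + N * (e - h) ≤ y₀ - N := by
      have : (e : ℤ) + 1 ≤ h := by exact_mod_cast hlt
      nlinarith
    have C₂' : Covered N S₂ (y₀ + N * (e - h)) := by
      intro y hy hys
      obtain ⟨z, hz, h1, h2⟩ := C₂ y (Finset.mem_insert_of_mem hy) hys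
      rcases Finset.mem_insert.1 hz with rfl | hz
      · omega
      · exact ⟨z, hz, h1, h2⟩
    rcases S₁.eq_empty_or_nonempty with rfl | hS
    · refine ⟨∅, S₂, by simp, rfl, fun y hy => by simp at hy, C₂', fun m => ?_⟩
      simp only [Finset.card_empty]
      omega
    · obtain ⟨f, hf, hmax⟩ := S₁.exists_max_image id hS
      simp only [id] at hmax
      have hfy : y₀ < f := by
        by_contra hcon
        have hf' : f ≠ y₀ := fun h => h₁ (h ▸ hf)
        obtain ⟨z, hz, h1, -⟩ := C₁ f hf (by omega)
        exact absurd (hmax z hz) (not_le.2 h1)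
      have hf2 : f ∉ S₂ := fun h => Finset.disjoint_left.1 hd hf h
      refine ⟨S₁.erase f, insert f S₂, ?_, ?_, ?_, C₂'.insert_of (Or.inl (by omega)), fun m => ?_⟩
      · rw [Finset.disjoint_insert_right]
        exact ⟨Finset.notMem_erase _ _, hd.mono_left (Finset.erase_subset _ _)⟩
      · rw [Finset.union_insert, ← Finset.insert_union, Finset.insert_erase hf]
      · intro y hy hys
        obtain ⟨-, hy⟩ := Finset.mem_erase.1 hy
        obtain ⟨z, hz, h1, h2⟩ := C₁ y hy (by omega)
        exact ⟨z, Finset.mem_erase.2 ⟨by omega, hz⟩, h1, h2⟩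
      · have := Finset.card_pos.2 hS
        rw [Finset.card_erase_of_mem hf, Finset.card_insert_of_notMem hf2]
        omega
  · have hs : y₀ + N ≤ y₀ + N * (e - h) := by
      have : (h : ℤ) + 1 ≤ e := by exact_mod_cast hgt
      nlinarith
    set s₂ := y₀ + N * (e - h) with hs₂
    have hH₂ : e ≤ h + (S₂.filter (y₀ < ·)).card := by
      have := C₂.card_above hN (e - h) y₀ (by simp) (by rw [Nat.cast_sub hgt.le])
      rw [Finset.filter_insert, if_neg (lt_irrefl _)] at this
      omega
    have hcard₂ : (S₂.filter (y₀ < ·)).card + (S₂.filter (· < y₀)).card = S₂.card := by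
      rw [← Finset.card_filter_add_card_filter_not (s := S₂) (y₀ < ·)]
      congr 2
      refine Finset.filter_congr fun y hy => ?_
      have : y ≠ y₀ := fun h => h₂ (h ▸ hy)
      omega
    have hcard₁ : (S₁.filter (y₀ < ·)).card + (S₁.filter (· < y₀)).card = S₁.card := by
      rw [← Finset.card_filter_add_card_filter_not (s := S₁) (y₀ < ·)]
      congr 2
      refine Finset.filter_congr fun y hy => ?_
      have : y ≠ y₀ := fun h => h₁ (h ▸ hy)
      omega
    -- everything above `y₀` in `S₁ ∪ S₂` that needs a cover has one above `y₀` in `S₂`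
    have hcov : ∀ y ∈ S₁ ∪ S₂, y₀ < y → y < s₂ → ∃ z ∈ S₂, y₀ < z ∧ y < z ∧ z < y + N := by
      intro y hy hy0 hys
      have : ∃ z ∈ insert y₀ S₂, y < z ∧ z < y + N := by
        by_cases hyS : y ∈ S₂
        · exact C₂ y (Finset.mem_insert_of_mem hyS) hys
        · exact C₂.exists_cover (Finset.mem_insert_self _ _) hy0
            (by simp [hyS, hy0.ne']) hys
      obtain ⟨z, hz, h1, h2⟩ := this
      rcases Finset.mem_insert.1 hz with rfl | hz
      · omega
      · exact ⟨z, hz, by omega, h1, h2⟩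
    by_cases hI : ∃ a ∈ S₁.filter (· < y₀), ∀ b ∈ S₂.filter (· < y₀), a < b
    · -- the least element of all those below `y₀` belongs to the first chain
      have hH₁ : (S₁.filter (y₀ < ·)).Nonempty := by
        obtain ⟨a, ha, -⟩ := hI
        rw [Finset.mem_filter] at ha
        obtain ⟨f, hf, hmax⟩ := S₁.exists_max_image id ⟨a, ha.1⟩
        refine ⟨f, Finset.mem_filter.2 ⟨hf, ?_⟩⟩
        by_contra hcon
        have hf' : f ≠ y₀ := fun h => h₁ (h ▸ hf)
        obtain ⟨z, hz, h1, -⟩ := C₁ f hf (by omega)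
        exact absurd (hmax z hz) (not_le.2 h1)
      obtain ⟨f, hf, hmin⟩ := (S₁.filter (y₀ < ·)).exists_min_image id hH₁
      simp only [id] at hmin
      have hf' := Finset.mem_filter.1 hf
      obtain ⟨A, hAn, hA, hAc⟩ := Covered.exists_chain (N := N) _ (S₁.filter (· < y₀)) f rfl
        (fun y hy => by
          rw [Finset.mem_filter] at hy
          refine ⟨by omega, ?_⟩
          obtain ⟨z, hz, h1, h2⟩ := C₁ y hy.1 hy.2
          rcases lt_or_ge z y₀ with hz0 | hz0
          · exact ⟨z, by simp [hz, hz0], h1, h2⟩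
          · have : z ≠ y₀ := fun h => h₁ (h ▸ hz)
            have := hmin z (Finset.mem_filter.2 ⟨hz, by omega⟩)
            exact ⟨f, by simp, by omega, by omega⟩)
      obtain ⟨B, hBn, hB, hBc⟩ := Covered.exists_chain (N := N) _ (S₂.filter (· < y₀)) y₀ rfl
        (fun y hy => by
          rw [Finset.mem_filter] at hy
          refine ⟨by omega, ?_⟩
          obtain ⟨z, hz, h1, h2⟩ := C₂ y (by simp [hy.1]) (by omega)
          rcases lt_or_ge z y₀ with hz0 | hz0
          · rcases Finset.mem_insert.1 hz with rfl | hz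
            · omega
            · exact ⟨z, by simp [hz, hz0], h1, h2⟩
          · exact ⟨y₀, by simp, by omega, by omega⟩)
      have memA : ∀ y, y ∈ A ↔ y ∈ S₁ ∧ y < y₀ := fun y => by
        rw [← List.mem_toFinset, hA, Finset.mem_filter]
      have memB : ∀ y, y ∈ B ↔ y ∈ S₂ ∧ y < y₀ := fun y => by
        rw [← List.mem_toFinset, hB, Finset.mem_filter]
      obtain ⟨A', B', hp, hcA, hcB, hlen, x, hx, hxmin⟩ := uncross A B f y₀ hAc hBc hf'.2
        (fun a ha => ((memA a).1 ha).2)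
        (by
          obtain ⟨a, ha, hab⟩ := hI
          rw [Finset.mem_filter] at ha
          refine ⟨a, (memA a).2 ha, fun b hb => hab b ?_⟩
          rw [Finset.mem_filter]
          exact (memB b).1 hb)
      have hnodup : (A' ++ B').Nodup := by
        rw [hp.nodup_iff, List.nodup_append]
        refine ⟨hAn, hBn, fun a ha b hb hab => ?_⟩
        subst hab
        exact Finset.disjoint_left.1 hd ((memA a).1 ha).1 ((memB a).1 hb).1
      rw [List.nodup_append] at hnodup
      have memAB : ∀ y, y ∈ A' ∨ y ∈ B' ↔ (y ∈ S₁ ∨ y ∈ S₂) ∧ y < y₀ := fun y => by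
        rw [← List.mem_append, hp.mem_iff, List.mem_append, memA, memB, or_and_right]
      have hAlt : ∀ y ∈ A', y < y₀ := fun y hy => ((memAB y).1 (Or.inl hy)).2
      have hBlt : ∀ y ∈ B', y < y₀ := fun y hy => ((memAB y).1 (Or.inr hy)).2
      refine exists_balanced (A := (S₁.filter (y₀ < ·)).erase f ∪ B'.toFinset)
        (B := insert f (S₂.filter (y₀ < ·)) ∪ A'.toFinset) hd ?_ ?_ ?_ ?_ ?_ ?_
      · rw [Finset.disjoint_left]
        intro y hy hy'
        simp only [Finset.mem_union, Finset.mem_erase, Finset.mem_filter, List.mem_toFinset,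
          Finset.mem_insert] at hy hy'
        rcases hy with ⟨h1, h2, h3⟩ | hy
        · rcases hy' with (h4 | h4) | h4
          · exact h1 h4
          · exact Finset.disjoint_left.1 hd h2 h4.1
          · have := hAlt y h4; omega
        · have := hBlt y hy
          rcases hy' with (h4 | h4) | h4
          · omega
          · omega
          · exact hnodup.2.2 y h4 y hy rfl
      · ext y
        have hy1 : y ∈ S₁ → y ≠ y₀ := fun h h' => h₁ (h' ▸ h)
        have hy2 : y ∈ S₂ → y ≠ y₀ := fun h h' => h₂ (h' ▸ h)
        have h3 := memAB y
        have h4 : y = f → y ∈ S₁ ∧ y₀ < y := by rintro rfl; exact hf'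
        simp only [Finset.mem_union, Finset.mem_erase, Finset.mem_filter, List.mem_toFinset,
          Finset.mem_insert]
        constructor
        · rintro ((h | h) | ((h | h) | h))
          · exact Or.inl h.2.1
          · exact (h3.1 (Or.inr h)).1
          · exact Or.inl (h4 h).1
          · exact Or.inr h.1
          · exact (h3.1 (Or.inl h)).1
        · intro h
          have hyy : y ≠ y₀ := h.elim hy1 hy2
          rcases lt_or_gt_of_ne hyy with hy | hy
          · rcases h3.2 ⟨h, hy⟩ with h | h
            · exact Or.inr (Or.inr h)
            · exact Or.inl (Or.inr h)
          · by_cases hyf : y = f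
            · exact Or.inr (Or.inl (Or.inl hyf))
            · rcases h with h | h
              · exact Or.inl (Or.inl ⟨hyf, h, hy⟩)
              · exact Or.inr (Or.inl (Or.inr ⟨h, hy⟩))
      · intro y hy hys
        simp only [Finset.mem_union, Finset.mem_erase, Finset.mem_filter, List.mem_toFinset] at hy
        rcases hy with ⟨-, -, h3⟩ | hy
        · omega
        · obtain ⟨z, hz, h1, h2⟩ := exists_cover_of_isChain hcB y hy
          rcases List.mem_cons.1 hz with rfl | hz
          · omega
          · exact ⟨z, by simp [hz], h1, h2⟩
      · intro y hy hys
        rw [Finset.mem_union, List.mem_toFinset] at hy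
        rcases hy with hy | hy
        · have hy' : y ∈ S₁ ∪ S₂ ∧ y₀ < y := by
            rcases Finset.mem_insert.1 hy with rfl | hy
            · exact ⟨Finset.mem_union_left _ hf'.1, hf'.2⟩
            · rw [Finset.mem_filter] at hy
              exact ⟨Finset.mem_union_right _ hy.1, hy.2⟩
          obtain ⟨z, hz, h0, h1, h2⟩ := hcov y hy'.1 hy'.2 hys
          exact ⟨z, by simp [hz, h0], h1, h2⟩
        · obtain ⟨z, hz, h1, h2⟩ := exists_cover_of_isChain hcA y hy
          refine ⟨z, ?_, h1, h2⟩
          rcases List.mem_cons.1 hz with rfl | hz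
          · simp
          · simp [hz]
      · intro y hy
        simp only [Finset.mem_union, Finset.mem_filter, List.mem_toFinset,
          Finset.mem_insert] at hy
        rcases hy with (rfl | hy) | hy
        · left; omega
        · left; omega
        · exact Or.inr ⟨x, by simp [hx], hxmin y hy⟩
      · have h1 : ((S₁.filter (y₀ < ·)).erase f ∪ B'.toFinset).card ≤
            (S₁.filter (y₀ < ·)).card - 1 + A.length := by
          refine (Finset.card_union_le _ _).trans ?_
          rw [Finset.card_erase_of_mem hf]
          have := List.toFinset_card_le B'
          omega
        have h2 : A.length = (S₁.filter (· < y₀)).card := by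
          rw [← hA, List.toFinset_card_of_nodup hAn]
        have := Finset.card_pos.2 hH₁
        omega
    · -- the least element belongs to the second chain, or there is nothing below `y₀`
      push Not at hI
      refine exists_balanced (A := S₂.filter (· < y₀)) (B := S₁ ∪ S₂.filter (y₀ < ·))
        hd ?_ ?_ ?_ ?_ ?_ ?_
      · rw [Finset.disjoint_union_right]
        refine ⟨hd.symm.mono_left (Finset.filter_subset _ _), ?_⟩
        rw [Finset.disjoint_left]
        intro y hy hy'
        rw [Finset.mem_filter] at hy hy'
        omega
      · ext y
        have hy2 : y ∈ S₂ → y ≠ y₀ := fun h h' => h₂ (h' ▸ h)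
        simp only [Finset.mem_union, Finset.mem_filter]
        constructor
        · rintro (h | h | h)
          · exact Or.inr h.1
          · exact Or.inl h
          · exact Or.inr h.1
        · rintro (h | h)
          · exact Or.inr (Or.inl h)
          · rcases lt_or_gt_of_ne (hy2 h) with hy | hy
            · exact Or.inl ⟨h, hy⟩
            · exact Or.inr (Or.inr ⟨h, hy⟩)
      · intro y hy hys
        rw [Finset.mem_filter] at hy
        obtain ⟨z, hz, h1, h2⟩ := C₂ y (Finset.mem_insert_of_mem hy.1) (by omega)
        rcases Finset.mem_insert.1 hz with rfl | hz
        · omega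
        · exact ⟨z, Finset.mem_filter.2 ⟨hz, by omega⟩, h1, h2⟩
      · intro y hy hys
        rcases lt_or_ge y y₀ with hy0 | hy0
        · have hy1 : y ∈ S₁ := by
            rcases Finset.mem_union.1 hy with hy | hy
            · exact hy
            · rw [Finset.mem_filter] at hy; omega
          obtain ⟨z, hz, h'⟩ := C₁ y hy1 hy0
          exact ⟨z, Finset.mem_union_left _ hz, h'⟩
        · have hyU : y ∈ S₁ ∪ S₂ := by
            rcases Finset.mem_union.1 hy with hy | hy
            · exact Finset.mem_union_left _ hy
            · exact Finset.mem_union_right _ (Finset.mem_filter.1 hy).1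
          have : y ≠ y₀ := by
            rintro rfl
            exact (Finset.mem_union.1 hyU).elim h₁ h₂
          obtain ⟨z, hz, h0, h1, h2⟩ := hcov y hyU (by omega) hys
          exact ⟨z, Finset.mem_union_right _ (Finset.mem_filter.2 ⟨hz, h0⟩), h1, h2⟩
      · intro y hy
        rcases lt_or_ge y y₀ with hy0 | hy0
        · have hy1 : y ∈ S₁ := by
            rcases Finset.mem_union.1 hy with hy | hy
            · exact hy
            · rw [Finset.mem_filter] at hy; omega
          obtain ⟨b, hb, hby⟩ := hI y (Finset.mem_filter.2 ⟨hy1, hy0⟩)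
          refine Or.inr ⟨b, hb, lt_of_le_of_ne hby ?_⟩
          rintro rfl
          exact Finset.disjoint_left.1 hd hy1 (Finset.mem_filter.1 hb).1
        · left; omega
      · omega

/-! ### Catabolism insertion -/

/-- The row `e` of the shape `ν` can be extended by a box. (Rows are indexed from `0`.) -/
def Addable (ν : ℕ → ℕ) (e : ℕ) : Prop := e = 0 ∨ ν e < ν (e - 1)

/-- The shape `ν` with a box added in row `e`. -/
def grow (ν : ℕ → ℕ) (e : ℕ) : ℕ → ℕ := Function.update ν e (ν e + 1)

open Classical in
/-- Catabolism insertion. The state is a shape `ν` and a queue of labels. If a box can be added to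
`ν` in the row given by the first label `e` of the queue, this is done and the label is removed;
otherwise the label becomes `e + 1` and moves to the end of the queue. `Eval μ k ν q` says that,
from the state `(ν, q)`, the queue is empty after at most `k` steps, and the shape is then `μ`. -/
def Eval (μ : ℕ → ℕ) : ℕ → (ℕ → ℕ) → List ℕ → Prop
  | _, ν, [] => ν = μ
  | 0, _, _ :: _ => False
  | k + 1, ν, e :: q => if Addable ν e then Eval μ k (grow ν e) q else Eval μ k ν (q ++ [e + 1])

section
variable {μ ν : ℕ → ℕ} {k e : ℕ} {q : List ℕ}

theorem eval_nil : Eval μ k ν [] ↔ ν = μ := by cases k <;> rfl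

theorem not_eval_zero (h : q ≠ []) : ¬ Eval μ 0 ν q := by
  cases q with
  | nil => exact absurd rfl h
  | cons e q => exact id

theorem eval_accept (h : Addable ν e) :
    Eval μ (k + 1) ν (e :: q) ↔ Eval μ k (grow ν e) q := by
  rw [Eval, if_pos h]

theorem eval_reject (h : ¬ Addable ν e) :
    Eval μ (k + 1) ν (e :: q) ↔ Eval μ k ν (q ++ [e + 1]) := by
  rw [Eval, if_neg h]

theorem addable_succ : Addable ν (e + 1) ↔ ν (e + 1) < ν e := by simp [Addable]

theorem grow_apply (i : ℕ) : grow ν e i = ν i + if i = e then 1 else 0 := by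
  unfold grow
  by_cases h : i = e
  · subst h; simp
  · simp [h]

theorem grow_comm (a c : ℕ) : grow (grow ν a) c = grow (grow ν c) a := by
  ext i; simp only [grow_apply]; omega

theorem addable_grow_iff {a c : ℕ} (h1 : c ≠ a) (h2 : c ≠ a + 1) :
    Addable (grow ν a) c ↔ Addable ν c := by
  unfold Addable
  simp only [grow_apply]
  rw [if_neg h1]
  by_cases hc : c = 0
  · simp [hc]
  · rw [if_neg (by omega)]; simp

end

/-- The elementary changes of a queue that do not influence the outcome of catabolism insertion:
labels that differ by at least two commute, and two relations hold between neighbouring labels. -/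
inductive ShortMove : List ℕ → List ℕ → Prop
  | far (a c : ℕ) (h : a + 2 ≤ c) : ShortMove [a, c] [c, a]
  | low (a : ℕ) : ShortMove [a, a + 1, a] [a, a, a + 1]
  | high (a : ℕ) : ShortMove [a + 1, a, a + 1] [a, a + 1, a + 1]

/-- Two queues differ by one elementary change, in either direction. -/
def QueueMove (q q' : List ℕ) : Prop :=
  ∃ p s x y, (ShortMove x y ∨ ShortMove y x) ∧ q = p ++ x ++ s ∧ q' = p ++ y ++ s

theorem QueueMove.symm {q q' : List ℕ} (h : QueueMove q q') : QueueMove q' q := by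
  obtain ⟨p, s, x, y, h, rfl, rfl⟩ := h
  exact ⟨p, s, y, x, h.symm, rfl, rfl⟩

theorem antitone_grow {ν : ℕ → ℕ} (hν : Antitone ν) {e : ℕ} (he : Addable ν e) :
    Antitone (grow ν e) := by
  refine antitone_nat_of_succ_le fun i => ?_
  have h1 : ν (i + 1) ≤ ν i := hν (Nat.le_succ i)
  simp only [grow_apply]
  by_cases hi : i + 1 = e
  · subst hi
    rw [addable_succ] at he
    rw [if_pos rfl, if_neg (by omega)]
    omega
  · rw [if_neg hi]; omega

theorem eval_head_move {μ : ℕ → ℕ} {n : ℕ}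
    (ih : ∀ m < n, ∀ (ν : ℕ → ℕ) (q q' : List ℕ), Antitone ν → QueueMove q q' →
      (Eval μ m ν q ↔ Eval μ m ν q'))
    {ν : ℕ → ℕ} (hν : Antitone ν) (s : List ℕ) {x y : List ℕ} (h : ShortMove x y) :
    Eval μ n ν (x ++ s) ↔ Eval μ n ν (y ++ s) := by
  cases h with
  | far a c hac =>
    match n, ih with
    | 0, _ => exact iff_of_false (not_eval_zero (by simp)) (not_eval_zero (by simp))
    | 1, _ =>
      by_cases ha : Addable ν a <;> by_cases hc : Addable ν c <;>
        simp only [List.cons_append, List.nil_append, eval_accept, eval_reject, ha, hc,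
          not_false_eq_true] <;>
        exact iff_of_false (not_eval_zero (by simp)) (not_eval_zero (by simp))
    | n + 2, ih =>
      have h1 : ∀ ν, Addable (grow ν a) c ↔ Addable ν c := fun ν =>
        addable_grow_iff (by omega) (by omega)
      have h2 : ∀ ν, Addable (grow ν c) a ↔ Addable ν a := fun ν =>
        addable_grow_iff (by omega) (by omega)
      by_cases ha : Addable ν a <;> by_cases hc : Addable ν c <;>
        simp only [List.cons_append, List.nil_append, eval_accept, eval_reject, ha, hc, h1, h2,
          not_false_eq_true, List.append_assoc]
      · rw [grow_comm]
      · exact ih n (by omega) _ _ _ hν ⟨s, [], [a + 1, c + 1], [c + 1, a + 1],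
          Or.inl (ShortMove.far _ _ (by omega)), by simp, by simp⟩
  | low a =>
    match n, ih with
    | 0, _ => exact iff_of_false (not_eval_zero (by simp)) (not_eval_zero (by simp))
    | 1, _ | 2, _ =>
      constructor <;> intro h <;> exfalso <;> revert h <;>
        simp only [List.cons_append, List.nil_append, Eval] <;> split_ifs <;> simp
    | n + 3, ih =>
      have h1 : ∀ ν, Addable (grow ν (a + 1)) a ↔ Addable ν a := fun ν =>
        addable_grow_iff (by omega) (by omega)
      have h2 : ∀ ν, Antitone ν → Addable (grow ν a) (a + 1) := fun ν hν => by
        have := hν (Nat.le_succ a)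
        rw [addable_succ]; simp only [grow_apply]; simp; omega
      by_cases ha : Addable ν a
      · have hν' := antitone_grow hν ha
        have h3 := h2 ν hν
        by_cases ha' : Addable (grow ν a) a
        · have h4 := h2 _ hν'
          simp only [List.cons_append, List.nil_append, eval_accept, ha, ha', h1, h3, h4]
          rw [grow_comm]
        · simp only [List.cons_append, List.nil_append, eval_accept, eval_reject, ha, ha', h1, h3,
            not_false_eq_true]
      · by_cases hc : Addable ν (a + 1)
        · simp only [List.cons_append, List.nil_append, eval_accept, eval_reject, ha, hc, h1,
            not_false_eq_true, List.append_assoc]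
        · simp only [List.cons_append, List.nil_append, eval_reject, ha, hc,
            not_false_eq_true, List.append_assoc]
          exact ih n (by omega) _ _ _ hν ⟨s, [], _, _, Or.inl (ShortMove.low (a + 1)),
            by simp, by simp⟩
  | high a =>
    match n, ih with
    | 0, _ => exact iff_of_false (not_eval_zero (by simp)) (not_eval_zero (by simp))
    | 1, _ | 2, _ =>
      constructor <;> intro h <;> exfalso <;> revert h <;>
        simp only [List.cons_append, List.nil_append, Eval] <;> split_ifs <;> simp
    | n + 3, ih =>
      have h0 := hν (Nat.le_succ a)
      have h1 : ∀ ν, Addable (grow ν (a + 1)) a ↔ Addable ν a := fun ν =>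
        addable_grow_iff (by omega) (by omega)
      have h2 : Addable (grow ν a) (a + 1) := by
        rw [addable_succ]; simp only [grow_apply]; simp; omega
      by_cases ha : Addable ν a
      · have h3 : Addable (grow (grow ν a) (a + 1)) (a + 1) ↔ Addable ν (a + 1) := by
          rw [addable_succ, addable_succ]; simp only [grow_apply]; simp
        by_cases hc : Addable ν (a + 1)
        · have h4 : Addable (grow (grow ν (a + 1)) a) (a + 1) := by
            rw [grow_comm]; exact h3.2 hc
          simp only [List.cons_append, List.nil_append, eval_accept, ha, hc, h1, h2, h3, h4]
          rw [grow_comm (ν := ν) (a + 1) a]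
        · simp only [List.cons_append, List.nil_append, eval_accept, eval_reject, ha, hc, h2, h3,
            not_false_eq_true]
      · by_cases hc : Addable ν (a + 1)
        · by_cases hc' : Addable (grow ν (a + 1)) (a + 1)
          · simp only [List.cons_append, List.nil_append, eval_accept, eval_reject, ha, hc, hc', h1,
              not_false_eq_true]
          · simp only [List.cons_append, List.nil_append, eval_accept, eval_reject, ha, hc, hc', h1,
              not_false_eq_true, List.append_assoc]
        · simp only [List.cons_append, List.nil_append, eval_reject, ha, hc,
            not_false_eq_true, List.append_assoc]
          exact ih n (by omega) _ _ _ hν ⟨s, [], _, _, Or.inl (ShortMove.high (a + 1)),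
            by simp, by simp⟩

/-- Catabolism insertion has the same outcome for two queues that differ by elementary changes:
when such a change reaches the head of the queue, the labels involved are treated in the same way,
or they are all rejected and the change reappears at the end of the queue. -/
theorem eval_iff_of_queueMove {μ : ℕ → ℕ} (n : ℕ) : ∀ (ν : ℕ → ℕ) (q q' : List ℕ), Antitone ν →
    QueueMove q q' → (Eval μ n ν q ↔ Eval μ n ν q') := by
  induction n using Nat.strong_induction_on with
  | _ n ih =>
    rintro ν _ _ hν ⟨p, s, x, y, hxy, rfl, rfl⟩
    match p with
    | [] =>
      rcases hxy with h | h
      · exact eval_head_move ih hν s h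
      · exact (eval_head_move ih hν s h).symm
    | e :: p =>
      match n, ih with
      | 0, _ => exact iff_of_false (not_eval_zero (by simp)) (not_eval_zero (by simp))
      | n + 1, ih =>
        by_cases he : Addable ν e
        · simp only [List.cons_append, eval_accept, he]
          exact ih n (by omega) _ _ _ (antitone_grow hν he) ⟨p, s, x, y, hxy, rfl, rfl⟩
        · simp only [List.cons_append, eval_reject, he, not_false_eq_true]
          exact ih n (by omega) _ _ _ hν ⟨p, s ++ [e + 1], x, y, hxy, by simp, by simp⟩

/-! ### Queues with visiting times -/

/-- The anchor of a label `x.2` that is visited at time `x.1`: as a rejected label is visited again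
`N` time units later, and is then one larger, its anchor does not change. -/
def anchor (N : ℤ) (x : ℤ × ℕ) : ℤ := x.1 - N * x.2

/-- The set of the anchors of a queue. -/
def anchors (N : ℤ) (L : List (ℤ × ℕ)) : Finset ℤ := (L.map (anchor N)).toFinset

/-- A queue of labels with the times of their next visits, which increase along the queue and
belong to the period of length `N` that begins at `t`. -/
def IsQueue (N t : ℤ) (L : List (ℤ × ℕ)) : Prop :=
  L.Pairwise (fun x y => x.1 < y.1) ∧ ∀ x ∈ L, t ≤ x.1 ∧ x.1 < t + N

section
variable {N t T : ℤ} {e h : ℕ} {L : List (ℤ × ℕ)}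

theorem mem_anchors {y : ℤ} : y ∈ anchors N L ↔ ∃ x ∈ L, anchor N x = y := by
  simp [anchors]

theorem anchors_cons (x : ℤ × ℕ) : anchors N (x :: L) = insert (anchor N x) (anchors N L) := by
  simp [anchors]

theorem anchors_reject : anchors N (L ++ [(T + N, e + 1)]) = anchors N ((T, e) :: L) := by
  have : anchor N (T + N, e + 1) = anchor N (T, e) := by simp [anchor]; ring
  ext y
  simp only [mem_anchors, List.mem_append, List.mem_cons, or_and_right, exists_or, exists_eq_left,
    this, List.not_mem_nil, or_false]
  exact or_comm

theorem IsQueue.accept (hL : IsQueue N t ((T, e) :: L)) : IsQueue N (T + 1) L := by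
  obtain ⟨h1, h2⟩ := hL
  rw [List.pairwise_cons] at h1
  refine ⟨h1.2, fun x hx => ?_⟩
  have h3 := h1.1 x hx
  have h4 := (h2 x (List.mem_cons_of_mem _ hx)).2
  have h5 := (h2 _ List.mem_cons_self).1
  simp only at h3 h5
  omega

theorem IsQueue.reject (hL : IsQueue N t ((T, e) :: L)) :
    IsQueue N (T + 1) (L ++ [(T + N, e + 1)]) := by
  have hN : 0 < N := by have := hL.2 _ List.mem_cons_self; omega
  obtain ⟨h1, h2⟩ := hL.accept
  refine ⟨?_, fun x hx => ?_⟩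
  · rw [List.pairwise_append]
    refine ⟨h1, by simp, fun x hx y hy => ?_⟩
    rw [List.mem_singleton] at hy
    subst hy
    have h3 := (hL.2 x (List.mem_cons_of_mem _ hx)).2
    have h4 := (hL.2 _ List.mem_cons_self).1
    simp only at h4 ⊢
    omega
  · rcases List.mem_append.1 hx with hx | hx
    · exact h2 x hx
    · rw [List.mem_singleton] at hx
      subst hx
      simp only
      omega

theorem IsQueue.head (hL : IsQueue N t ((T, e) :: L)) : IsQueue N T ((T, e) :: L) := by
  refine ⟨hL.1, fun x hx => ?_⟩
  have h1 := (hL.2 x hx).2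
  have h2 := (hL.2 _ List.mem_cons_self)
  simp only at h2
  rcases List.mem_cons.1 hx with rfl | hx
  · simp only; omega
  · have := (List.pairwise_cons.1 hL.1).1 x hx
    simp only at this
    omega

/-- A visit that is not in the past at time `t` is not in the past after the next visit. -/
theorem IsQueue.advance (hL : IsQueue N t ((T, e) :: L)) {y : ℤ} (hy : y ∈ anchors N L)
    (hty : t ≤ y + N * h) : T + 1 ≤ y + N * h := by
  obtain ⟨x, hx, rfl⟩ := mem_anchors.1 hy
  have h1 := (hL.2 x (List.mem_cons_of_mem _ hx)).2
  have h2 := (List.pairwise_cons.1 hL.1).1 x hx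
  simp only [anchor] at h2 hty ⊢
  by_contra hcon
  have h3 : 0 < N * ((x.2 : ℤ) - h) := by linarith
  have h4 : N * ((x.2 : ℤ) - h) < N * 1 := by linarith
  have hN : 0 < N := by have := hL.2 _ List.mem_cons_self; omega
  have h5 := lt_of_mul_lt_mul_left h4 hN.le
  have h6 := pos_of_mul_pos_right h3 hN.le
  omega

theorem IsQueue.anchor_notMem (hL : IsQueue N t ((T, e) :: L)) :
    anchor N (T, e) ∉ anchors N L := fun hmem => by
  have := hL.head.advance (h := e) hmem (by simp [anchor])
  simp [anchor] at this

theorem Covered.advance {S : Finset ℤ} (hL : IsQueue N t ((T, e) :: L)) (hS : S ⊆ anchors N L)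
    (hC : Covered N S (t - N * h)) : Covered N S (T + 1 - N * h) := by
  intro y hy hyt
  refine hC y hy ?_
  by_contra hcon
  have := hL.advance (h := h) (hS hy) (by linarith)
  linarith

theorem Covered.advance_of_ne {S : Finset ℤ} (hL : IsQueue N t ((T, e) :: L))
    (hS : S ⊆ anchors N ((T, e) :: L)) (hC : Covered N S (t - N * h)) (hne : h ≠ e) :
    Covered N S (T + 1 - N * h) := by
  intro y hy hyt
  refine hC y hy ?_
  rw [anchors_cons] at hS
  rcases Finset.mem_insert.1 (hS hy) with rfl | hy'
  · have h0 := hL.2 _ List.mem_cons_self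
    simp only [anchor] at hyt h0 ⊢
    have hN : 0 < N := by omega
    have h1 : (h : ℤ) < e := by
      rcases lt_or_gt_of_ne hne with h2 | h2
      · exact_mod_cast h2
      · have : (e : ℤ) + 1 ≤ h := by exact_mod_cast h2
        nlinarith
    have : (h : ℤ) + 1 ≤ e := h1
    nlinarith
  · by_contra hcon
    have := hL.advance (h := h) hy' (by linarith)
    linarith

/-- After the acceptance of a label at the height of the chain, the other elements of the chain
are still covered. -/
theorem Covered.accept {S : Finset ℤ} (hL : IsQueue N t ((T, e) :: L))
    (hC : Covered N (insert (anchor N (T, e)) S) (t - N * e)) :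
    Covered N S (T + 1 - N * (e + 1 : ℕ)) := by
  intro y hy hyt
  have h0 := hL.2 _ List.mem_cons_self
  simp only at h0
  push_cast at hyt
  obtain ⟨z, hz, h1, h2⟩ := hC y (Finset.mem_insert_of_mem hy) (by linarith)
  rcases Finset.mem_insert.1 hz with rfl | hz
  · simp only [anchor] at h2
    linarith
  · exact ⟨z, hz, h1, h2⟩

/-- Adding a label that is accepted at the height of the chain. -/
theorem Covered.cons {S : Finset ℤ} (hL : IsQueue N t ((T, e) :: L))
    (hC : Covered N S (T + 1 - N * (e + 1 : ℕ))) :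
    Covered N (insert (anchor N (T, e)) S) (t - N * e) := by
  intro y hy hyt
  have h0 := hL.2 _ List.mem_cons_self
  simp only at h0
  push_cast at hC
  rcases Finset.mem_insert.1 hy with rfl | hy
  · simp only [anchor] at hyt
    linarith
  · by_cases hlt : y < T + 1 - N * (e + 1)
    · obtain ⟨z, hz, h'⟩ := hC y hy hlt
      exact ⟨z, Finset.mem_insert_of_mem hz, h'⟩
    · refine ⟨_, Finset.mem_insert_self _ _, ?_⟩
      simp only [anchor]
      constructor <;> linarith

end

/-- If the anchors of the queue are covered at the height of the current shape, then catabolism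
insertion comes to an end: the largest anchor is accepted, at the latest, when it is visited at
this height. -/
theorem exists_eval {N : ℤ} : ∀ (n : ℕ) (L : List (ℤ × ℕ)) (ν : ℕ → ℕ) (t : ℤ) (h : ℕ),
    L.length = n → (∀ a, 0 < ν a ↔ a < h) → IsQueue N t L →
    Covered N (anchors N L) (t - N * h) → ∃ k μ, Eval μ k ν (L.map Prod.snd)
  | 0, L, ν, _, _, hn, _, _, _ => by
    rw [List.length_eq_zero_iff] at hn
    subst hn
    exact ⟨0, ν, eval_nil.2 rfl⟩
  | n + 1, L, ν, t, h, hn, hν, hL, hC => by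
    have key : ∀ (D : ℕ) (L : List (ℤ × ℕ)) (t : ℤ), L.length = n + 1 → IsQueue N t L →
        Covered N (anchors N L) (t - N * h) → (∀ y ∈ anchors N L, y + N * h < t + D) →
        ∃ k μ, Eval μ k ν (L.map Prod.snd) := by
      intro D
      induction D with
      | zero =>
        intro L t hn hL hC hD
        have hne : (anchors N L).Nonempty := by
          obtain ⟨x, hx⟩ := List.exists_mem_of_length_pos (l := L) (by omega)
          exact ⟨_, mem_anchors.2 ⟨x, hx, rfl⟩⟩
        obtain ⟨y, hy, hmax⟩ := (anchors N L).exists_max_image id hne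
        have := hD y hy
        obtain ⟨z, hz, h1, -⟩ := hC y hy (by push_cast at this; linarith)
        exact absurd (hmax z hz) (not_le.2 h1)
      | succ D ihD =>
        intro L t hn hL hC hD
        match L, hn, hL, hC, hD with
        | (T, e) :: L, hn, hL, hC, hD =>
          have hT := (hL.2 _ List.mem_cons_self).1
          simp only at hT
          by_cases he : Addable ν e
          · have heh : e ≤ h := by
              rcases he with rfl | he
              · exact Nat.zero_le _
              · have := (hν (e - 1)).1 (by omega)
                omega
            have hsub : anchors N L ⊆ anchors N ((T, e) :: L) := by
              rw [anchors_cons]; exact Finset.subset_insert _ _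
            obtain ⟨k, μ, hk⟩ : ∃ k μ, Eval μ k (grow ν e) (L.map Prod.snd) := by
              have hn' : L.length = n := by simpa using hn
              rcases heh.eq_or_lt with rfl | heh
              · refine exists_eval n L _ (T + 1) (e + 1) hn' (fun a => ?_) hL.accept ?_
                · rw [grow_apply]
                  have := hν a
                  by_cases hae : a = e
                  · subst hae; simp
                  · rw [if_neg hae]; omega
                · rw [anchors_cons] at hC
                  exact hC.accept hL
              · refine exists_eval n L _ (T + 1) h hn' (fun a => ?_) hL.accept ?_
                · rw [grow_apply]
                  have := hν a
                  by_cases hae : a = e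
                  · subst hae; simp [heh]
                  · rw [if_neg hae]; omega
                · -- the anchor of the accepted label is too large to be needed as a cover
                  have h1 := hC.advance_of_ne hL subset_rfl heh.ne'
                  intro y hy hyt
                  obtain ⟨z, hz, h2, h3⟩ := h1 y (hsub hy) hyt
                  rw [anchors_cons] at hz
                  rcases Finset.mem_insert.1 hz with rfl | hz
                  · have hN : 0 < N := by have := hL.2 _ List.mem_cons_self; omega
                    have : (e : ℤ) + 1 ≤ h := by exact_mod_cast heh
                    simp only [anchor] at h3
                    nlinarith
                  · exact ⟨z, hz, h2, h3⟩
            exact ⟨k + 1, μ, (eval_accept he).2 hk⟩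
          · have heh : h ≠ e := by
              rintro rfl
              refine he ?_
              rcases Nat.eq_zero_or_pos h with h0 | h0
              · exact Or.inl h0
              · right
                have h1 := (hν (h - 1)).2 (by omega)
                have h2 := (hν h).not.2 (lt_irrefl _)
                omega
            obtain ⟨k, μ, hk⟩ := ihD (L ++ [(T + N, e + 1)]) (T + 1) (by simpa using hn) hL.reject
              (by rw [anchors_reject]; exact hC.advance_of_ne hL subset_rfl heh)
              (fun y hy => by
                rw [anchors_reject] at hy
                have := hD y hy
                push_cast at this
                linarith)
            refine ⟨k + 1, μ, (eval_reject he).2 ?_⟩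
            simpa using hk
    obtain ⟨D, hD⟩ : ∃ D : ℕ, ∀ y ∈ anchors N L, y + N * h < t + D := by
      refine ⟨((anchors N L).sup fun y => (y + N * h - t).toNat) + 1, fun y hy => ?_⟩
      have h1 := Finset.le_sup (f := fun y => (y + N * h - t).toNat) hy
      have h2 := Int.self_le_toNat (y + N * h - t)
      push_cast
      have h3 : (((y + N * h - t).toNat : ℕ) : ℤ) ≤
        (((anchors N L).sup fun y => (y + N * h - t).toNat : ℕ) : ℤ) := by exact_mod_cast h1
      linarith
    exact key D L t hn hL hC hD

/-! ### Chains and shapes -/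

section
variable {ι : Type*} [DecidableEq ι]

/-- The elements of `R` that have the colour `c`. -/
def colourClass (R : Finset ℤ) (κ : ℤ → ι) (c : ι) : Finset ℤ := R.filter fun y => κ y = c

theorem mem_colourClass {R : Finset ℤ} {κ : ℤ → ι} {c : ι} {y : ℤ} :
    y ∈ colourClass R κ c ↔ y ∈ R ∧ κ y = c := Finset.mem_filter

theorem colourClass_insert (R : Finset ℤ) (κ : ℤ → ι) (c : ι) (y : ℤ) :
    colourClass (insert y R) κ c =
      if κ y = c then insert y (colourClass R κ c) else colourClass R κ c :=
  Finset.filter_insert _ _ _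

theorem colourClass_update {R : Finset ℤ} {κ : ℤ → ι} {y : ℤ} (hy : y ∉ R) (j c : ι) :
    colourClass R (Function.update κ y j) c = colourClass R κ c := by
  refine Finset.filter_congr fun z hz => ?_
  have : z ≠ y := fun h => hy (h ▸ hz)
  simp [this]

end

section
variable {ι : Type*} [Fintype ι]

theorem sum_card_lt_eq (H : ι → ℕ) (m : ℕ) :
    ∑ a ∈ Finset.range m, (Finset.univ.filter fun j => a < H j).card = ∑ j, min m (H j) := by
  simp only [Finset.card_filter]
  rw [Finset.sum_comm]
  refine Finset.sum_congr rfl fun j _ => ?_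
  rw [← Finset.card_filter]
  have : (Finset.range m).filter (fun a => a < H j) = Finset.range (min m (H j)) := by
    ext a; simp
  rw [this, Finset.card_range]

/-- A box can be added in row `e` exactly if there is a column of height `e`. -/
theorem exists_height_iff {ν : ℕ → ℕ} {h : ι → ℕ} {e : ℕ} {q : List ℕ}
    (hν : ∀ a, ν a = (Finset.univ.filter fun j => a < h j).card)
    (hz : (e :: q).count 0 ≤ (Finset.univ.filter fun j => h j = 0).card) :
    Addable ν e ↔ ∃ j, h j = e := by
  rcases Nat.eq_zero_or_pos e with rfl | he
  · refine iff_of_true (Or.inl rfl) ?_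
    rw [List.count_cons_self] at hz
    obtain ⟨j, hj⟩ := Finset.card_pos.1 (by omega : 0 < (Finset.univ.filter fun j => h j = 0).card)
    exact ⟨j, (Finset.mem_filter.1 hj).2⟩
  · have hsub : (Finset.univ.filter fun j => e < h j) ⊆
        (Finset.univ.filter fun j => e - 1 < h j) := fun j hj => by
      simp only [Finset.mem_filter, Finset.mem_univ, true_and] at hj ⊢; omega
    unfold Addable
    rw [hν, hν]
    constructor
    · rintro (h0 | h0)
      · omega
      · obtain ⟨j, hj, hj'⟩ := Finset.exists_mem_notMem_of_card_lt_card h0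
        simp only [Finset.mem_filter, Finset.mem_univ, true_and] at hj hj'
        exact ⟨j, by omega⟩
    · rintro ⟨j, hj⟩
      refine Or.inr (Finset.card_lt_card ⟨hsub, fun hcon => ?_⟩)
      have := hcon (x := j) (by simp only [Finset.mem_filter, Finset.mem_univ, true_and]; omega)
      simp only [Finset.mem_filter, Finset.mem_univ, true_and] at this
      omega

variable [DecidableEq ι]

theorem card_lt_update {h : ι → ℕ} {j : ι} {e : ℕ} (hj : h j = e) (a : ℕ) :
    (Finset.univ.filter fun i => a < Function.update h j (e + 1) i).card =
      (Finset.univ.filter fun i => a < h i).card + if a = e then 1 else 0 := by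
  by_cases ha : a = e
  · subst ha
    have : (Finset.univ.filter fun i => a < Function.update h j (a + 1) i) =
        insert j (Finset.univ.filter fun i => a < h i) := by
      ext i
      by_cases hi : i = j
      · subst hi; simp
      · simp [hi]
    rw [this, if_pos rfl, Finset.card_insert_of_notMem (by simp [hj])]
  · rw [if_neg ha, add_zero]
    congr 1
    ext i
    by_cases hi : i = j
    · subst hi; simp; omega
    · simp [hi]

theorem card_zero_update {h : ι → ℕ} {j : ι} {e : ℕ} (hj : h j = e) :
    (Finset.univ.filter fun i => Function.update h j (e + 1) i = 0).card +
      (if e = 0 then 1 else 0) = (Finset.univ.filter fun i => h i = 0).card := by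
  by_cases he : e = 0
  · subst he
    have : (Finset.univ.filter fun i => Function.update h j (0 + 1) i = 0) =
        (Finset.univ.filter fun i => h i = 0).erase j := by
      ext i
      by_cases hi : i = j
      · subst hi; simp
      · simp [hi]
    rw [this, if_pos rfl, Finset.card_erase_add_one (by simp [hj])]
  · rw [if_neg he, add_zero]
    congr 1
    ext i
    by_cases hi : i = j
    · subst hi; simp; omega
    · simp [hi]

theorem grow_eq_card {ν : ℕ → ℕ} {h : ι → ℕ} {j : ι} {e : ℕ}
    (hν : ∀ a, ν a = (Finset.univ.filter fun j => a < h j).card) (hj : h j = e) (a : ℕ) :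
    grow ν e a = (Finset.univ.filter fun i => a < Function.update h j (e + 1) i).card := by
  rw [grow_apply, card_lt_update hj, hν]

theorem count_le_update {h : ι → ℕ} {j : ι} {e : ℕ} {q : List ℕ} (hj : h j = e)
    (hz : (e :: q).count 0 ≤ (Finset.univ.filter fun j => h j = 0).card) :
    q.count 0 ≤ (Finset.univ.filter fun i => Function.update h j (e + 1) i = 0).card := by
  have := card_zero_update hj
  rw [List.count_cons] at hz
  by_cases he : e = 0
  · subst he
    rw [if_pos rfl] at this
    rw [if_pos (by simp)] at hz
    omega
  · rw [if_neg he] at this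
    rw [if_neg (by simpa using he)] at hz
    omega

theorem count_reject {e c : ℕ} {q : List ℕ} (hz : (e :: q).count 0 ≤ c) :
    (q ++ [e + 1]).count 0 ≤ c := by
  rw [List.count_append, List.count_singleton]
  rw [List.count_cons] at hz
  simp
  omega

/-- If catabolism insertion turns the shape with columns `h` into the shape `μ`, then the queue
can be divided into covered chains, one for each column, whose lengths are the numbers of boxes
by which the columns grow. -/
theorem exists_chains [Nonempty ι] {N : ℤ} {μ : ℕ → ℕ} : ∀ (k : ℕ) (L : List (ℤ × ℕ)) (ν : ℕ → ℕ)
    (t : ℤ) (h : ι → ℕ), Eval μ k ν (L.map Prod.snd) → IsQueue N t L →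
    (∀ a, ν a = (Finset.univ.filter fun j => a < h j).card) →
    (L.map Prod.snd).count 0 ≤ (Finset.univ.filter fun j => h j = 0).card →
    ∃ κ : ℤ → ι, (∀ j, Covered N (colourClass (anchors N L) κ j) (t - N * h j)) ∧
      ∀ a, μ a = (Finset.univ.filter fun j => a < h j + (colourClass (anchors N L) κ j).card).card
  | k, [], ν, t, h, hE, _, hν, _ => by
    rw [List.map_nil, eval_nil] at hE
    subst hE
    refine ⟨fun _ => Classical.arbitrary ι, fun j y hy => ?_, fun a => ?_⟩
    · simp [colourClass, anchors] at hy
    · simp [colourClass, anchors, hν]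
  | 0, x :: L, _, _, _, hE, _, _, _ => absurd hE (not_eval_zero (by simp))
  | k + 1, (T, e) :: L, ν, t, h, hE, hL, hν, hz => by
    rw [List.map_cons] at hE hz
    by_cases he : Addable ν e
    · obtain ⟨j, hj⟩ := (exists_height_iff hν hz).1 he
      obtain ⟨κ, hκ, hμ⟩ := exists_chains k L (grow ν e) (T + 1) (Function.update h j (e + 1))
        ((eval_accept he).1 hE) hL.accept (grow_eq_card hν hj) (count_le_update hj hz)
      have hnot := hL.anchor_notMem
      have hclass : ∀ c, colourClass (anchors N ((T, e) :: L))
          (Function.update κ (anchor N (T, e)) j) c =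
          if j = c then insert (anchor N (T, e)) (colourClass (anchors N L) κ c)
          else colourClass (anchors N L) κ c := fun c => by
        rw [anchors_cons, colourClass_insert, colourClass_update hnot, Function.update_self]
      refine ⟨Function.update κ (anchor N (T, e)) j, fun c => ?_, fun a => ?_⟩
      · rw [hclass]
        have h1 := hκ c
        by_cases hc : j = c
        · subst hc
          rw [if_pos rfl]
          rw [Function.update_self] at h1
          rw [hj]
          exact h1.cons hL
        · rw [if_neg hc]
          rw [Function.update_of_ne (Ne.symm hc)] at h1
          have := (hL.2 _ List.mem_cons_self).1
          simp only at this
          exact h1.mono (by linarith)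
      · rw [hμ]
        congr 1
        ext c
        simp only [Finset.mem_filter, Finset.mem_univ, true_and]
        rw [hclass]
        by_cases hc : j = c
        · subst hc
          rw [if_pos rfl, Function.update_self, Finset.card_insert_of_notMem, hj]
          · omega
          · exact fun hmem => hnot (mem_colourClass.1 hmem).1
        · rw [if_neg hc, Function.update_of_ne (Ne.symm hc)]
    · obtain ⟨κ, hκ, hμ⟩ := exists_chains k (L ++ [(T + N, e + 1)]) ν (T + 1) h
        (by simpa using (eval_reject he).1 hE) hL.reject hν
        (by rw [List.map_append]; exact count_reject hz)
      rw [anchors_reject] at hκ hμ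
      refine ⟨κ, fun j => (hκ j).mono ?_, hμ⟩
      have := (hL.2 _ List.mem_cons_self).1
      simp only at this
      linarith

theorem sum_le_sum_of_pair {f g : ι → ℕ} {i j : ι} (hij : i ≠ j)
    (h : ∀ c, c ≠ i → c ≠ j → f c = g c) (h' : f i + f j ≤ g i + g j) :
    ∑ c, f c ≤ ∑ c, g c := by
  have hj : j ∈ Finset.univ.erase i := by simp [hij.symm]
  rw [← Finset.add_sum_erase _ f (Finset.mem_univ i),
    ← Finset.add_sum_erase _ g (Finset.mem_univ i),
    ← Finset.add_sum_erase _ f hj, ← Finset.add_sum_erase _ g hj]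
  have : ∑ c ∈ (Finset.univ.erase i).erase j, f c = ∑ c ∈ (Finset.univ.erase i).erase j, g c :=
    Finset.sum_congr rfl fun c hc => h c (by simp at hc; tauto) (by simp at hc; tauto)
  omega

/-- However a queue is divided into covered chains, catabolism insertion does at least as well, in
dominance order, as letting the columns grow by these chains. Whenever a label is accepted in
another column than that of its chain, the chains can be rearranged by the exchange lemma. -/
theorem sum_min_le {N : ℤ} {μ : ℕ → ℕ} (m : ℕ) : ∀ (k : ℕ) (L : List (ℤ × ℕ)) (ν : ℕ → ℕ)
    (t : ℤ) (h : ι → ℕ) (κ : ℤ → ι), Eval μ k ν (L.map Prod.snd) → IsQueue N t L →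
    (∀ a, ν a = (Finset.univ.filter fun j => a < h j).card) →
    (L.map Prod.snd).count 0 ≤ (Finset.univ.filter fun j => h j = 0).card →
    (∀ j, Covered N (colourClass (anchors N L) κ j) (t - N * h j)) →
    ∑ j, min m (h j + (colourClass (anchors N L) κ j).card) ≤ ∑ a ∈ Finset.range m, μ a
  | k, [], ν, t, h, κ, hE, _, hν, _, _ => by
    rw [List.map_nil, eval_nil] at hE
    subst hE
    simp only [hν, sum_card_lt_eq]
    simp [colourClass, anchors]
  | 0, x :: L, _, _, _, _, hE, _, _, _, _ => absurd hE (not_eval_zero (by simp))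
  | k + 1, (T, e) :: L, ν, t, h, κ, hE, hL, hν, hz, hC => by
    rw [List.map_cons] at hE hz
    have hadd := exists_height_iff hν hz
    have hsubL : ∀ c, colourClass (anchors N ((T, e) :: L)) κ c ⊆ anchors N ((T, e) :: L) :=
      fun c => Finset.filter_subset _ _
    by_cases he : Addable ν e
    · have hnot := hL.anchor_notMem
      have hsub : ∀ c, colourClass (anchors N L) κ c ⊆ anchors N L :=
        fun c => Finset.filter_subset _ _
      set y₀ := anchor N (T, e) with hy₀
      set R := anchors N L with hR
      have hy₀' : y₀ = T - N * e := rfl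
      have hnot' : ∀ c, y₀ ∉ colourClass R κ c := fun c hc => hnot (hsub c hc)
      set j := κ y₀ with hj
      rw [anchors_cons, ← hy₀, ← hR] at hC hsubL ⊢
      have hj1 : colourClass (insert y₀ R) κ j = insert y₀ (colourClass R κ j) := by
        rw [colourClass_insert, if_pos rfl]
      have hj2 : ∀ c, c ≠ j → colourClass (insert y₀ R) κ c = colourClass R κ c := fun c hc => by
        rw [colourClass_insert, if_neg (Ne.symm hc)]
      have hcj := hC j
      rw [hj1] at hcj
      by_cases hje : h j = e
      · -- the label is accepted in the column of its chain
        refine le_trans (le_of_eq ?_) (sum_min_le m k L (grow ν e) (T + 1)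
          (Function.update h j (e + 1)) κ ((eval_accept he).1 hE) hL.accept (grow_eq_card hν hje)
          (count_le_update hje hz) fun c => ?_)
        · refine Finset.sum_congr rfl fun c _ => ?_
          by_cases hc : c = j
          · subst hc
            rw [← hR, hj1, Function.update_self, Finset.card_insert_of_notMem (hnot' _), hje]
            congr 1
            omega
          · rw [hj2 c hc, Function.update_of_ne hc]
        · by_cases hc : c = j
          · subst hc
            rw [Function.update_self]
            rw [hje] at hcj
            exact hcj.accept hL
          · rw [Function.update_of_ne hc]
            have := hC c
            rw [hj2 c hc] at this
            exact this.advance hL (hsub c)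
      · obtain ⟨i, hi⟩ := hadd.1 he
        have hij : i ≠ j := fun h' => hje (h' ▸ hi)
        have hN : 0 < N := by have := hL.2 _ List.mem_cons_self; omega
        have hd : Disjoint (colourClass R κ i) (colourClass R κ j) := by
          rw [Finset.disjoint_left]
          intro y h1 h2
          exact hij ((mem_colourClass.1 h1).2.symm.trans (mem_colourClass.1 h2).2)
        obtain ⟨A, B, hAB, hU, hA, hB, hmin⟩ := exchange (y₀ := y₀) (e := e) (h := h j) hN
          (Ne.symm hje) hd (hnot' i) (hnot' j)
          (by
            have := hC i
            rw [hj2 i hij, hi] at this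
            exact (this.advance hL (hsub i)).mono (by rw [hy₀']; linarith))
          (by
            refine (hcj.advance_of_ne hL ?_ hje).mono (by rw [hy₀']; linarith)
            rw [← hj1, anchors_cons]
            exact hsubL j)
        have memAB : ∀ y, y ∈ A ∨ y ∈ B ↔ y ∈ R ∧ (κ y = i ∨ κ y = j) := fun y => by
          rw [← Finset.mem_union, hU, Finset.mem_union, mem_colourClass, mem_colourClass,
            and_or_left]
        set κ' : ℤ → ι := fun y => if y ∈ A then i else if y ∈ B then j else κ y with hκ'
        have hci : colourClass R κ' i = A := by
          ext y
          have h1 := memAB y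
          rw [mem_colourClass]
          simp only [hκ']
          by_cases hyA : y ∈ A
          · simp only [hyA, if_true, and_true, iff_true]
            exact (h1.1 (Or.inl hyA)).1
          · by_cases hyB : y ∈ B
            · simp [hyA, hyB, hij.symm]
            · simp only [hyA, hyB, if_false, iff_false]
              rintro ⟨h2, h3⟩
              exact (h1.2 ⟨h2, Or.inl h3⟩).elim hyA hyB
        have hcj' : colourClass R κ' j = B := by
          ext y
          have h1 := memAB y
          rw [mem_colourClass]
          simp only [hκ']
          by_cases hyA : y ∈ A
          · have : y ∉ B := Finset.disjoint_left.1 hAB hyA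
            simp [hyA, this, hij]
          · by_cases hyB : y ∈ B
            · simp only [hyA, hyB, if_false, if_true, and_true, iff_true]
              exact (h1.1 (Or.inr hyB)).1
            · simp only [hyA, hyB, if_false, iff_false]
              rintro ⟨h2, h3⟩
              exact (h1.2 ⟨h2, Or.inr h3⟩).elim hyA hyB
        have hcc : ∀ c, c ≠ i → c ≠ j → colourClass R κ' c = colourClass R κ c := fun c h1 h2 => by
          ext y
          have h3 := memAB y
          rw [mem_colourClass, mem_colourClass]
          refine and_congr_right fun hy => ?_
          simp only [hκ']
          split_ifs with h4 h5
          · have := (h3.1 (Or.inl h4)).2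
            refine iff_of_false (Ne.symm h1) ?_
            rintro rfl
            exact this.elim h1 h2
          · have := (h3.1 (Or.inr h5)).2
            refine iff_of_false (Ne.symm h2) ?_
            rintro rfl
            exact this.elim h1 h2
          · rfl
        have hAR : ∀ y, y ∈ A ∨ y ∈ B → y ∈ R := fun y hy => ((memAB y).1 hy).1
        refine le_trans ?_ (sum_min_le m k L (grow ν e) (T + 1)
          (Function.update h i (e + 1)) κ' ((eval_accept he).1 hE) hL.accept (grow_eq_card hν hi)
          (count_le_update hi hz) fun c => ?_)
        · refine sum_le_sum_of_pair hij (fun c h1 h2 => ?_) ?_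
          · rw [hj2 c h2, hcc c h1 h2, Function.update_of_ne h1]
          · rw [hj1, hj2 i hij, ← hR, hci, hcj', Function.update_self,
              Function.update_of_ne hij.symm, Finset.card_insert_of_notMem (hnot' _), hi]
            have := hmin m
            rwa [show h j + ((colourClass R κ j).card + 1) = h j + 1 + (colourClass R κ j).card by
              omega]
        · rw [← hR]
          by_cases h1 : c = i
          · subst h1
            rw [hci, Function.update_self]
            refine hA.mono ?_
            rw [hy₀']
            push_cast
            linarith
          · rw [Function.update_of_ne h1]
            by_cases h2 : c = j
            · subst h2
              rw [hcj']
              refine Covered.advance hL.head (fun y hy => hAR y (Or.inr hy)) (hB.mono ?_)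
              rw [hy₀']
              linarith
            · rw [hcc c h1 h2]
              have := hC c
              rw [hj2 c h2] at this
              exact this.advance hL (hsub c)
    · refine le_trans (le_of_eq ?_) (sum_min_le m k (L ++ [(T + N, e + 1)]) ν (T + 1) h κ
        (by simpa using (eval_reject he).1 hE) hL.reject hν
        (by rw [List.map_append]; exact count_reject hz) fun c => ?_)
      · rw [anchors_reject]
      · rw [anchors_reject]
        exact (hC c).advance_of_ne hL (hsubL c) fun h' => he (hadd.2 ⟨c, h'⟩)

end

/-! ### Schensted insertion and Knuth equivalence -/

/-- The elementary Knuth relations. -/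
inductive KnuthStep : List ℕ → List ℕ → Prop
  | left (p s : List ℕ) {a b c : ℕ} (hab : a < b) (hbc : b < c) :
      KnuthStep (p ++ a :: c :: b :: s) (p ++ c :: a :: b :: s)
  | right (p s : List ℕ) {a b c : ℕ} (hab : a < b) (hbc : b < c) :
      KnuthStep (p ++ b :: a :: c :: s) (p ++ b :: c :: a :: s)

/-- Knuth equivalence of words. -/
def Knuth : List ℕ → List ℕ → Prop := Relation.EqvGen KnuthStep

theorem Knuth.refl (w : List ℕ) : Knuth w w := Relation.EqvGen.refl w

theorem Knuth.trans {u v w : List ℕ} (h : Knuth u v) (h' : Knuth v w) : Knuth u w :=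
  Relation.EqvGen.trans _ _ _ h h'

theorem KnuthStep.knuth {v w : List ℕ} (h : KnuthStep v w) : Knuth v w := Relation.EqvGen.rel _ _ h

theorem Knuth.symm {v w : List ℕ} (h : Knuth v w) : Knuth w v := Relation.EqvGen.symm _ _ h

theorem KnuthStep.perm {v w : List ℕ} (h : KnuthStep v w) : v.Perm w := by
  cases h with
  | left p s _ _ => exact (List.Perm.swap _ _ _).append_left p
  | right p s _ _ => exact ((List.Perm.swap _ _ _).cons _).append_left p

theorem Knuth.perm {v w : List ℕ} (h : Knuth v w) : v.Perm w := by
  induction h with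
  | rel _ _ h => exact h.perm
  | refl => exact List.Perm.refl _
  | symm _ _ _ ih => exact ih.symm
  | trans _ _ _ _ _ ih₁ ih₂ => exact ih₁.trans ih₂

theorem Knuth.append {v w : List ℕ} (h : Knuth v w) (p s : List ℕ) :
    Knuth (p ++ v ++ s) (p ++ w ++ s) := by
  induction h with
  | rel _ _ h =>
    cases h with
    | left p' s' h1 h2 => simpa using (KnuthStep.left (p ++ p') (s' ++ s) h1 h2).knuth
    | right p' s' h1 h2 => simpa using (KnuthStep.right (p ++ p') (s' ++ s) h1 h2).knuth
  | refl => exact Knuth.refl _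
  | symm _ _ _ ih => exact ih.symm
  | trans _ _ _ _ _ ih₁ ih₂ => exact ih₁.trans ih₂

theorem rowInsert_none {x : ℕ} : ∀ {r : List ℕ}, (rowInsert x r).2 = none →
    (rowInsert x r).1 = r ++ [x] ∧ ∀ u ∈ r, u ≤ x
  | [], _ => by simp [rowInsert]
  | y :: r, h => by
    unfold rowInsert at h ⊢
    split_ifs at h ⊢ with hxy
    obtain ⟨h1, h2⟩ := rowInsert_none (r := r) h
    simp only [h1, List.cons_append, true_and]
    intro u hu
    rcases List.mem_cons.1 hu with rfl | hu
    · omega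
    · exact h2 u hu

theorem rowInsert_some {x y : ℕ} : ∀ {r : List ℕ}, r.Pairwise (· < ·) → x ∉ r →
    (rowInsert x r).2 = some y → Knuth (r ++ [x]) (y :: (rowInsert x r).1) ∧ y ∈ r ∧ x < y ∧
      (∀ u ∈ r, u ≤ x ∨ y ≤ u) ∧ (rowInsert x r).1.Pairwise (· < ·)
  | [], _, _, h => by simp [rowInsert] at h
  | a :: r, hr, hx, h => by
    rw [List.pairwise_cons] at hr
    rw [List.mem_cons, not_or] at hx
    unfold rowInsert at h ⊢
    by_cases hxa : x < a
    · rw [if_pos hxa] at h ⊢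
      simp only [Option.some.injEq] at h
      subst h
      refine ⟨?_, by simp, hxa, fun u hu => Or.inr ?_, ?_⟩
      · -- `x` moves to the left past all the letters of `r`
        have key : ∀ (r p : List ℕ), (a :: r).Pairwise (· < ·) →
            Knuth (p ++ a :: r ++ [x]) (p ++ a :: x :: r) := by
          intro r
          induction r using List.reverseRecOn with
          | nil => intro p _; simpa using Knuth.refl (p ++ [a, x])
          | append_singleton r b ih =>
            intro p hp
            have h1 : Knuth (p ++ a :: r ++ [b] ++ [x]) (p ++ a :: r ++ [x] ++ [b]) := by
              rcases List.eq_nil_or_concat r with rfl | ⟨r', c, rfl⟩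
              · have := (List.pairwise_cons.1 hp).1 b (by simp)
                simpa using (KnuthStep.right p [] hxa this).knuth.symm
              · rw [List.pairwise_cons] at hp
                have h2 := hp.1 c (by simp)
                have h3 : c < b := by
                  have := hp.2
                  rw [List.pairwise_append] at this
                  exact this.2.2 c (by simp) b (by simp)
                simpa using (KnuthStep.right (p ++ a :: r') [] (hxa.trans h2) h3).knuth.symm
            have hp' : (a :: r).Pairwise (· < ·) :=
              hp.sublist ((List.sublist_append_left r [b]).cons_cons a)
            have h2 := (ih p hp').append [] [b]
            simp only [List.nil_append, List.append_assoc, List.cons_append] at h1 h2 ⊢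
            exact h1.trans h2
        have h1 := key r [] (List.pairwise_cons.2 hr)
        simpa using h1
      · rcases List.mem_cons.1 hu with rfl | hu
        · exact le_rfl
        · exact (hr.1 u hu).le
      · exact List.pairwise_cons.2 ⟨fun u hu => hxa.trans (hr.1 u hu), hr.2⟩
    · rw [if_neg hxa] at h ⊢
      simp only at h ⊢
      obtain ⟨h1, h2, h3, h4, h5⟩ := rowInsert_some hr.2 hx.2 h
      have hax : a < x := by omega
      have hperm := h1.perm
      have hmem : ∀ u ∈ (rowInsert x r).1, a < u := fun u hu => by
        have : u ∈ r ++ [x] := hperm.symm.subset (List.mem_cons_of_mem _ hu)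
        rcases List.mem_append.1 this with hu | hu
        · exact hr.1 u hu
        · rw [List.mem_singleton] at hu; omega
      refine ⟨?_, List.mem_cons_of_mem _ h2, h3, fun u hu => ?_, List.pairwise_cons.2 ⟨hmem, h5⟩⟩
      · have h6 := h1.append [a] []
        simp only [List.append_nil] at h6
        refine Knuth.trans (by simpa using h6) ?_
        -- the first entry `b` of the new row satisfies `a < b < y`
        match hb : (rowInsert x r).1 with
        | [] =>
          have := hperm.length_eq
          have h7 : 0 < r.length := List.length_pos_of_mem h2
          simp only [hb, List.length_append, List.length_cons, List.length_nil] at this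
          omega
        | b :: r' =>
          have hby : b < y := by
            match r, hr, h, h2, hb with
            | c :: r, hr, h, h2, hb =>
              unfold rowInsert at h hb
              split_ifs at h hb with hxc
              · simp only [Option.some.injEq, List.cons.injEq] at h hb
                omega
              · simp only [List.cons.injEq] at h hb
                obtain ⟨rfl, -⟩ := hb
                rcases List.mem_cons.1 h2 with rfl | h2
                · omega
                · exact (List.pairwise_cons.1 hr.2).1 y h2
          have hab := hmem b (by simp [hb])
          simpa using (KnuthStep.left [] r' hab hby).knuth
      · rcases List.mem_cons.1 hu with rfl | hu
        · left; omega
        · exact h4 u hu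

/-- The reading word of a tableau. -/
def readingWord (T : List (List ℕ)) : List ℕ := T.reverse.flatten

theorem readingWord_cons (r : List ℕ) (T : List (List ℕ)) :
    readingWord (r :: T) = readingWord T ++ r := by simp [readingWord]

theorem upperWord_append_firstRow (T : List (List ℕ)) :
    upperWord T ++ firstRow T = readingWord T := by
  cases T <;> simp [upperWord, firstRow, readingWord]

/-- The entries of the row `s`, placed above the row `r`, are larger than the entries below them.
For increasing rows this can be said by counting: for every `t`, the entries `≤ t` of `s` are at
most as many as the entries `< t` of `r`. -/
def ColumnStrict (r s : List ℕ) : Prop :=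
  ∀ t, s.countP (fun u => decide (u ≤ t)) ≤ r.countP (fun u => decide (u < t))

theorem countP_lt_of_mem {y t : ℕ} (hyt : y < t) : ∀ {r : List ℕ}, y ∈ r →
    r.countP (fun u => decide (u < y)) + 1 ≤ r.countP (fun u => decide (u < t))
  | a :: r, h => by
    rw [List.countP_cons, List.countP_cons]
    have hmono : r.countP (fun u => decide (u < y)) ≤ r.countP (fun u => decide (u < t)) :=
      List.countP_mono_left fun u _ hu => by simp only [decide_eq_true_eq] at hu ⊢; omega
    by_cases hay : a = y
    · subst hay
      simp [hyt]
      exact hmono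
    · have ih := countP_lt_of_mem hyt ((List.mem_cons.1 h).resolve_left (Ne.symm hay))
      simp only [decide_eq_true_eq]
      split_ifs <;> omega

theorem columnStrict_rowInsert {r s : List ℕ} {x y : ℕ} (hrs : ColumnStrict r s)
    (hr : r.Pairwise (· < ·)) (hs : s.Pairwise (· < ·)) (hx : x ∉ r) (hys : y ∉ s)
    (hxy : (rowInsert x r).2 = some y) :
    ColumnStrict (rowInsert x r).1 (rowInsert y s).1 := by
  obtain ⟨h1, h2, h3, -, -⟩ := rowInsert_some hr hx hxy
  intro t
  have c1 := h1.perm.countP_eq (fun u => decide (u < t))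
  simp only [List.countP_append, List.countP_cons, List.countP_nil, decide_eq_true_eq,
    zero_add] at c1
  have H := hrs t
  have Hy := hrs y
  -- the slack that is used when `y` has entered the upper row but no larger entry has left it
  have key : y ≤ t → s.countP (fun u => decide (u ≤ t)) ≤ s.countP (fun u => decide (u ≤ y)) →
      s.countP (fun u => decide (u ≤ t)) + 1 ≤
        (rowInsert x r).1.countP (fun u => decide (u < t)) := fun hyt hst => by
    rcases hyt.eq_or_lt with rfl | hyt
    · rw [if_pos h3, if_neg (lt_irrefl _)] at c1
      omega
    · have := countP_lt_of_mem hyt h2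
      rw [if_pos (h3.trans hyt), if_pos hyt] at c1
      omega
  cases hz : (rowInsert y s).2 with
  | none =>
    obtain ⟨h4, h5⟩ := rowInsert_none hz
    rw [h4, List.countP_append, List.countP_singleton]
    simp only [decide_eq_true_eq]
    by_cases hyt : y ≤ t
    · rw [if_pos hyt]
      exact key hyt (List.countP_mono_left fun u hu _ => by simpa using h5 u hu)
    · rw [if_neg hyt]
      rw [if_neg (by omega : ¬ y < t)] at c1
      split_ifs at c1 <;> omega
  | some z =>
    obtain ⟨h4, h5, h6, h7, -⟩ := rowInsert_some hs hys hz
    have c2 := h4.perm.countP_eq (fun u => decide (u ≤ t))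
    simp only [List.countP_append, List.countP_cons, List.countP_nil, decide_eq_true_eq,
      zero_add] at c2
    by_cases hyt : y ≤ t
    · by_cases hzt : z ≤ t
      · rw [if_pos (by omega), if_pos (by omega)] at c1 c2
        omega
      · rw [if_pos hyt, if_neg hzt] at c2
        have := key hyt (List.countP_mono_left fun u hu hut => by
          simp only [decide_eq_true_eq] at hut ⊢
          have := h7 u hu
          omega)
        omega
    · rw [if_neg hyt, if_neg (by omega)] at c2
      rw [if_neg (by omega : ¬ y < t)] at c1
      split_ifs at c1 <;> omega

/-- A tableau: the rows and the columns are increasing. -/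
def IsTableau (T : List (List ℕ)) : Prop :=
  (∀ r ∈ T, r.Pairwise (· < ·)) ∧ T.IsChain ColumnStrict

theorem tabInsert_cons_none {x : ℕ} {r : List ℕ} {T : List (List ℕ)}
    (h : (rowInsert x r).2 = none) : tabInsert x (r :: T) = (rowInsert x r).1 :: T := by
  unfold tabInsert
  split
  · next h' => rw [h']
  · next h' => rw [h'] at h; simp at h

theorem tabInsert_cons_some {x y : ℕ} {r : List ℕ} {T : List (List ℕ)}
    (h : (rowInsert x r).2 = some y) :
    tabInsert x (r :: T) = (rowInsert x r).1 :: tabInsert y T := by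
  conv_lhs => unfold tabInsert
  split
  · next h' => rw [h'] at h; simp at h
  · next h' =>
    rw [h'] at h ⊢
    simp only [Option.some.injEq] at h
    rw [h]

theorem tabInsert_spec : ∀ (T : List (List ℕ)) (x : ℕ), IsTableau T → (readingWord T).Nodup →
    x ∉ readingWord T → IsTableau (tabInsert x T) ∧
      (tabInsert x T).head? = some (rowInsert x (firstRow T)).1 ∧
      Knuth (readingWord T ++ [x]) (readingWord (tabInsert x T))
  | [], x, _, _, _ => by
    refine ⟨⟨by simp [tabInsert], by simp [tabInsert]⟩, by simp [tabInsert, firstRow, rowInsert],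
      ?_⟩
    simpa [tabInsert, readingWord] using Knuth.refl _
  | r :: T, x, hT, hn, hx => by
    have hr := hT.1 r (by simp)
    have hT' : IsTableau T := ⟨fun s hs => hT.1 s (by simp [hs]), hT.2.of_cons⟩
    rw [readingWord_cons] at hn hx ⊢
    rw [List.mem_append, not_or] at hx
    rw [List.nodup_append] at hn
    cases h : (rowInsert x r).2 with
    | none =>
      rw [tabInsert_cons_none h, readingWord_cons]
      obtain ⟨h1, h2⟩ := rowInsert_none h
      refine ⟨⟨fun s hs => ?_, ?_⟩, by simp [firstRow], ?_⟩
      · rcases List.mem_cons.1 hs with rfl | hs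
        · rw [h1, List.pairwise_append]
          refine ⟨hr, by simp, fun u hu v hv => ?_⟩
          rw [List.mem_singleton] at hv
          subst hv
          exact lt_of_le_of_ne (h2 u hu) fun h' => hx.2 (h' ▸ hu)
        · exact hT'.1 s hs
      · have := hT.2
        rw [List.isChain_cons] at this ⊢
        refine ⟨fun s hs t => (this.1 s hs t).trans ?_, this.2⟩
        rw [h1, List.countP_append]
        exact Nat.le_add_right _ _
      · rw [h1, List.append_assoc]
        exact Knuth.refl _
    | some y =>
      rw [tabInsert_cons_some h, readingWord_cons]
      obtain ⟨h1, h2, h3, -, h5⟩ := rowInsert_some hr hx.2 h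
      have hyT : y ∉ readingWord T := fun hy => hn.2.2 y hy y h2 rfl
      obtain ⟨i1, i2, i3⟩ := tabInsert_spec T y hT' hn.1 hyT
      refine ⟨⟨fun s hs => ?_, ?_⟩, by simp [firstRow], ?_⟩
      · rcases List.mem_cons.1 hs with rfl | hs
        · exact h5
        · exact i1.1 s hs
      · rw [List.isChain_cons]
        refine ⟨fun s hs => ?_, i1.2⟩
        rw [i2, Option.mem_some_iff] at hs
        subst hs
        refine columnStrict_rowInsert ?_ hr ?_ hx.2 ?_ h
        · cases T with
          | nil => intro t; simp [firstRow]
          | cons s T => exact (List.isChain_cons_cons.1 hT.2).1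
        · cases T with
          | nil => simp [firstRow]
          | cons s T => exact hT'.1 s (by simp)
        · intro hy
          apply hyT
          rw [← upperWord_append_firstRow]
          exact List.mem_append_right _ hy
      · have h6 := h1.append (readingWord T) []
        have h7 := i3.append [] (rowInsert x r).1
        simp only [List.append_nil, List.nil_append, List.append_assoc, List.cons_append] at h6 h7 ⊢
        exact h6.trans h7

/-- A word of distinct letters is Knuth equivalent to the reading word of its insertion tableau. -/
theorem P_spec (w : List ℕ) (hw : w.Nodup) : IsTableau (P w) ∧ Knuth w (readingWord (P w)) := by
  induction w using List.reverseRecOn with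
  | nil => exact ⟨⟨by simp [P], by simp [P]⟩, Knuth.refl _⟩
  | append_singleton w x ih =>
    rw [List.nodup_append] at hw
    obtain ⟨h1, h2⟩ := ih hw.1
    have hP : P (w ++ [x]) = tabInsert x (P w) := by simp [P]
    have hx : x ∉ readingWord (P w) := fun h =>
      hw.2.2 x (h2.perm.symm.subset h) x (by simp) rfl
    obtain ⟨h3, -, h4⟩ := tabInsert_spec (P w) x h1 (h2.perm.nodup hw.1) hx
    rw [hP]
    refine ⟨h3, Knuth.trans ?_ h4⟩
    simpa using h2.append [] [x]

/-! ### Cocharge labels -/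

/-- The cocharge word of a word in the letters `1, …, n`. -/
def cochargeWord (w : List ℕ) : List ℕ := w.map (cochargeLabel w)

/-- The word `w` contains each of the letters `1, …, n` exactly once. -/
def IsStandard (n : ℕ) (w : List ℕ) : Prop := w.Nodup ∧ ∀ x, x ∈ w ↔ 1 ≤ x ∧ x ≤ n

theorem IsStandard.perm {n : ℕ} {w w' : List ℕ} (h : IsStandard n w) (hp : w.Perm w') :
    IsStandard n w' :=
  ⟨hp.nodup h.1, fun x => by rw [← hp.mem_iff]; exact h.2 x⟩

theorem cochargeLabel_succ (w : List ℕ) {i : ℕ} (hi : 1 ≤ i) : cochargeLabel w (i + 1) =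
    cochargeLabel w i + if w.idxOf (i + 1) < w.idxOf i then 1 else 0 := by
  obtain ⟨i, rfl⟩ := Nat.exists_eq_add_of_le' hi
  rfl

theorem monotone_cochargeLabel (w : List ℕ) : Monotone (cochargeLabel w) := by
  refine monotone_nat_of_le_succ fun i => ?_
  rcases Nat.eq_zero_or_pos i with rfl | hi
  · exact le_rfl
  · rw [cochargeLabel_succ w hi]
    exact Nat.le_add_right _ _

/-- Letters with equal labels occur in increasing order. -/
theorem idxOf_le_of_label_eq {w : List ℕ} {b c : ℕ} (hb : 1 ≤ b) (hbc : b ≤ c)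
    (h : cochargeLabel w b = cochargeLabel w c) : w.idxOf b ≤ w.idxOf c := by
  induction c, hbc using Nat.le_induction with
  | base => exact le_rfl
  | succ c hbc ih =>
    have h1 := monotone_cochargeLabel w hbc
    have h2 := cochargeLabel_succ w (hb.trans hbc)
    split_ifs at h2 with h3
    · omega
    · exact (ih (by omega)).trans (not_lt.1 h3)

theorem label_lt_of_idxOf_lt {w : List ℕ} {b c : ℕ} (hb : 1 ≤ b) (hbc : b ≤ c)
    (h : w.idxOf c < w.idxOf b) : cochargeLabel w b < cochargeLabel w c :=
  lt_of_le_of_ne (monotone_cochargeLabel w hbc)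
    fun h' => absurd (idxOf_le_of_label_eq hb hbc h') (not_le.2 h)

theorem idxOf_lt_of_append {l₁ l₂ : List ℕ} (h : (l₁ ++ l₂).Nodup) {x y : ℕ} (hx : x ∈ l₁)
    (hy : y ∈ l₂) : (l₁ ++ l₂).idxOf x < (l₁ ++ l₂).idxOf y := by
  have hy' : y ∉ l₁ := fun h' => (List.nodup_append.1 h).2.2 y h' y hy rfl
  rw [List.idxOf_append_of_mem hx, List.idxOf_append_of_notMem hy']
  have := List.idxOf_lt_length_of_mem hx
  omega

theorem pairwise_of_idxOf {w : List ℕ} (hw : w.Nodup) {R : ℕ → ℕ → Prop}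
    (h : ∀ x ∈ w, ∀ y ∈ w, w.idxOf x < w.idxOf y → R x y) : w.Pairwise R := by
  rw [List.pairwise_iff_getElem]
  intro i j hi hj hij
  refine h _ (List.getElem_mem hi) _ (List.getElem_mem hj) ?_
  rwa [hw.idxOf_getElem, hw.idxOf_getElem]

theorem idxOf_lt_of_pairwise : ∀ {w : List ℕ}, w.Pairwise (· < ·) → ∀ {x y : ℕ}, x ∈ w → y ∈ w →
    x < y → w.idxOf x < w.idxOf y
  | a :: w, h, x, y, hx, hy, hxy => by
    rw [List.pairwise_cons] at h
    rcases List.mem_cons.1 hy with rfl | hy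
    · rcases List.mem_cons.1 hx with rfl | hx
      · omega
      · have := h.1 x hx; omega
    · have hay := h.1 y hy
      rw [List.idxOf_cons_ne _ hay.ne]
      rcases List.mem_cons.1 hx with rfl | hx
      · rw [List.idxOf_cons_self]; omega
      · rw [List.idxOf_cons_ne _ (h.1 x hx).ne]
        have := idxOf_lt_of_pairwise h.2 hx hy hxy
        omega

/-- Swapping two neighbouring letters changes the relative order of no other pair of letters. -/
theorem idxOf_swap (p s : List ℕ) {a c x y : ℕ} (h1 : ¬ (x = a ∧ y = c))
    (h2 : ¬ (x = c ∧ y = a)) :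
    (p ++ a :: c :: s).idxOf x < (p ++ a :: c :: s).idxOf y ↔
      (p ++ c :: a :: s).idxOf x < (p ++ c :: a :: s).idxOf y := by
  have aux : ∀ z, z ∈ p → p.idxOf z < p.length := fun z hz => List.idxOf_lt_length_of_mem hz
  have hx := aux x
  have hy := aux y
  simp only [List.idxOf_append, List.idxOf_cons, cond_eq_ite, beq_iff_eq]
  by_cases hxp : x ∈ p <;> by_cases hyp : y ∈ p <;>
    simp only [hxp, hyp, if_true, if_false, forall_true_left] at hx hy ⊢ <;>
    split_ifs <;> omega

theorem cochargeLabel_swap (p s : List ℕ) {a c : ℕ} (hac : a + 2 ≤ c) (i : ℕ) :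
    cochargeLabel (p ++ a :: c :: s) i = cochargeLabel (p ++ c :: a :: s) i := by
  induction i with
  | zero => rfl
  | succ i ih =>
    rcases Nat.eq_zero_or_pos i with rfl | hi
    · rfl
    · rw [cochargeLabel_succ _ hi, cochargeLabel_succ _ hi, ih]
      simp only [idxOf_swap p s (a := a) (c := c) (x := i + 1) (y := i) (by omega) (by omega)]

/-- A Knuth relation between words of distinct letters becomes an elementary change of queues. -/
theorem KnuthStep.queueMove {w w' : List ℕ} (h : KnuthStep w w') (hw : w.Nodup)
    (hpos : ∀ x ∈ w, 1 ≤ x) :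
    QueueMove (cochargeWord w).reverse (cochargeWord w').reverse := by
  cases h with
  | @left p s a b c hab hbc =>
    have hlab : cochargeLabel (p ++ c :: a :: b :: s) = cochargeLabel (p ++ a :: c :: b :: s) :=
      funext fun i => (cochargeLabel_swap p (b :: s) (by omega) i).symm
    unfold cochargeWord
    rw [hlab]
    set f := cochargeLabel (p ++ a :: c :: b :: s) with hf
    have h1 : f a ≤ f b := monotone_cochargeLabel _ hab.le
    have h2 : f b < f c := by
      refine label_lt_of_idxOf_lt (hpos b (by simp)) hbc.le ?_
      have e : p ++ a :: c :: b :: s = (p ++ [a, c]) ++ b :: s := by simp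
      rw [e] at hw ⊢
      exact idxOf_lt_of_append hw (by simp) (by simp)
    by_cases hfar : f a + 2 ≤ f c
    · exact ⟨(s.map f).reverse ++ [f b], (p.map f).reverse, _, _, Or.inr (ShortMove.far _ _ hfar),
        by simp, by simp⟩
    · have h3 : f b = f a := by omega
      have h4 : f c = f a + 1 := by omega
      exact ⟨(s.map f).reverse, (p.map f).reverse, _, _, Or.inl (ShortMove.low (f a)),
        by simp [h3, h4], by simp [h3, h4]⟩
  | @right p s a b c hab hbc =>
    have hlab : cochargeLabel (p ++ b :: c :: a :: s) = cochargeLabel (p ++ b :: a :: c :: s) :=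
      funext fun i => by
        have := cochargeLabel_swap (p ++ [b]) s (by omega : a + 2 ≤ c) i
        simpa using this.symm
    unfold cochargeWord
    rw [hlab]
    set f := cochargeLabel (p ++ b :: a :: c :: s) with hf
    have h1 : f b ≤ f c := monotone_cochargeLabel _ hbc.le
    have h2 : f a < f b := by
      refine label_lt_of_idxOf_lt (hpos a (by simp)) hab.le ?_
      have e : p ++ b :: a :: c :: s = (p ++ [b]) ++ a :: c :: s := by simp
      rw [e] at hw ⊢
      exact idxOf_lt_of_append hw (by simp) (by simp)
    by_cases hfar : f a + 2 ≤ f c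
    · exact ⟨(s.map f).reverse, f b :: (p.map f).reverse, _, _, Or.inr (ShortMove.far _ _ hfar),
        by simp, by simp⟩
    · have h3 : f b = f a + 1 := by omega
      have h4 : f c = f a + 1 := by omega
      exact ⟨(s.map f).reverse, (p.map f).reverse, _, _, Or.inl (ShortMove.high (f a)),
        by simp [h3, h4], by simp [h3, h4]⟩

theorem Knuth.eval_iff {μ : ℕ → ℕ} {k : ℕ} {w w' : List ℕ} (h : Knuth w w') (hw : w.Nodup)
    (hpos : ∀ x ∈ w, 1 ≤ x) : Eval μ k (fun _ => 0) (cochargeWord w).reverse ↔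
      Eval μ k (fun _ => 0) (cochargeWord w').reverse := by
  induction h with
  | rel _ _ h => exact eval_iff_of_queueMove _ _ _ _ antitone_const (h.queueMove hw hpos)
  | refl => rfl
  | symm v v' h ih =>
    have hp := Knuth.perm h
    exact (ih (hp.symm.nodup hw) fun x hx => hpos x (hp.subset hx)).symm
  | trans u v v' h _ ih₁ ih₂ =>
    have hp := Knuth.perm h
    exact (ih₁ hw hpos).trans (ih₂ (hp.nodup hw) fun x hx => hpos x (hp.symm.subset hx))

/-- If the word `v ++ r` is turned into `r ++ v`, where `r` contains the letter `1`, then the labels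
of the letters of `v` decrease by one, and those of the letters of `r` do not change. -/
theorem cochargeLabel_rotate {n : ℕ} {v r : List ℕ} (hw : IsStandard n (v ++ r))
    (h1 : 1 ∈ v ++ r → 1 ∈ r) : ∀ i, 1 ≤ i → i ≤ n →
      (i ∈ r → cochargeLabel (r ++ v) i = cochargeLabel (v ++ r) i) ∧
      (i ∈ v → cochargeLabel (r ++ v) i + 1 = cochargeLabel (v ++ r) i) := by
  have hvr : ∀ x, x ∈ v → x ∉ r := fun x hx hx' =>
    (List.nodup_append.1 hw.1).2.2 x hx x hx' rfl
  have hlv : ∀ x, x ∈ v → v.idxOf x < v.length := fun x => List.idxOf_lt_length_of_mem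
  have hlr : ∀ x, x ∈ r → r.idxOf x < r.length := fun x => List.idxOf_lt_length_of_mem
  intro i hi
  induction i, hi using Nat.le_induction with
  | base =>
    intro hn
    have h1r := h1 ((hw.2 1).2 ⟨le_rfl, hn⟩)
    exact ⟨fun _ => rfl, fun h => absurd h1r (hvr 1 h)⟩
  | succ i hi ih =>
    intro hn
    obtain ⟨ih1, ih2⟩ := ih (by omega)
    rw [cochargeLabel_succ _ hi, cochargeLabel_succ _ hi]
    simp only [List.idxOf_append]
    have hmem := (hw.2 i).2 ⟨hi, by omega⟩
    rw [List.mem_append] at hmem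
    have a1 := hvr i
    have a2 := hvr (i + 1)
    have b1 := hlv i
    have b2 := hlv (i + 1)
    have c1 := hlr i
    have c2 := hlr (i + 1)
    by_cases d1 : i ∈ v <;> by_cases d2 : i + 1 ∈ v <;> by_cases e1 : i ∈ r <;>
      by_cases e2 : i + 1 ∈ r <;>
      simp only [d1, d2, e1, e2, if_true, if_false, forall_true_left, not_true, or_self,
        false_implies, and_true, true_and] at a1 a2 b1 b2 c1 c2 ih1 ih2 hmem ⊢ <;>
      split_ifs <;> omega

/-! ### Catabolism and catabolism insertion -/

/-- Catabolism insertion, from the state `(ν, q)`, ends with the shape `μ`. -/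
def Outcome (ν : ℕ → ℕ) (q : List ℕ) (μ : ℕ → ℕ) : Prop := ∃ k, Eval μ k ν q

theorem outcome_accept {ν μ : ℕ → ℕ} {e : ℕ} {q : List ℕ} (he : Addable ν e) :
    Outcome ν (e :: q) μ ↔ Outcome (grow ν e) q μ :=
  ⟨fun ⟨k, hk⟩ => match k, hk with
    | 0, hk => absurd hk (not_eval_zero (by simp))
    | k + 1, hk => ⟨k, (eval_accept he).1 hk⟩,
   fun ⟨k, hk⟩ => ⟨k + 1, (eval_accept he).2 hk⟩⟩

theorem outcome_reject {ν μ : ℕ → ℕ} {e : ℕ} {q : List ℕ} (he : ¬ Addable ν e) :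
    Outcome ν (e :: q) μ ↔ Outcome ν (q ++ [e + 1]) μ :=
  ⟨fun ⟨k, hk⟩ => match k, hk with
    | 0, hk => absurd hk (not_eval_zero (by simp))
    | k + 1, hk => ⟨k, (eval_reject he).1 hk⟩,
   fun ⟨k, hk⟩ => ⟨k + 1, (eval_reject he).2 hk⟩⟩

theorem outcome_zero_append {μ : ℕ → ℕ} : ∀ (A q : List ℕ), (∀ x ∈ A, 1 ≤ x) →
    (Outcome (fun _ => 0) (A ++ q) μ ↔ Outcome (fun _ => 0) (q ++ A.map (· + 1)) μ)
  | [], q, _ => by simp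
  | a :: A, q, hA => by
    have ha : ¬ Addable (fun _ => 0) a := by
      have := hA a (by simp)
      simp only [Addable]
      omega
    rw [List.cons_append, outcome_reject ha, List.append_assoc,
      outcome_zero_append A _ fun x hx => hA x (by simp [hx])]
    simp

theorem outcome_replicate_append {μ : ℕ → ℕ} : ∀ (d : ℕ) (ν : ℕ → ℕ) (q : List ℕ),
    (Outcome ν (List.replicate d 0 ++ q) μ ↔ Outcome (fun i => if i = 0 then ν 0 + d else ν i) q μ)
  | 0, ν, q => by
    have : (fun i => if i = 0 then ν 0 + 0 else ν i) = ν := by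
      funext i
      split_ifs with h
      · rw [h]; rfl
      · rfl
    rw [this]
    simp
  | d + 1, ν, q => by
    rw [List.replicate_succ, List.cons_append, outcome_accept (Or.inl rfl),
      outcome_replicate_append d]
    have : (fun i => if i = 0 then grow ν 0 0 + d else grow ν 0 i) =
        fun i => if i = 0 then ν 0 + (d + 1) else ν i := by
      funext i
      simp only [grow_apply]
      split_ifs <;> omega
    rw [this]

/-- The shape with the first two rows replaced by one row with `c` boxes. -/
def squash (c : ℕ) (ν : ℕ → ℕ) : ℕ → ℕ := fun i => if i = 0 then c else ν (i + 1)

theorem squash_grow (c : ℕ) (ν : ℕ → ℕ) (e : ℕ) :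
    squash c (grow ν (e + 2)) = grow (squash c ν) (e + 1) := by
  funext i
  simp only [squash, grow_apply]
  by_cases hi : i = 0
  · simp [hi]
  · simp [hi]

/-- A label `≥ 3` is compared with the rows from the third one on only. So, as long as all labels
are `≥ 3`, the first two rows can be replaced by one row of any size if the labels are decreased
by one. -/
theorem outcome_squash {μ : ℕ → ℕ} (c : ℕ) : ∀ (k : ℕ) (ν : ℕ → ℕ) (q : List ℕ), Eval μ k ν q →
    (∀ x ∈ q, 3 ≤ x) → μ 0 = ν 0 ∧ μ 1 = ν 1 ∧
      Outcome (squash c ν) (q.map (· - 1)) (squash c μ)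
  | k, ν, [], hE, _ => by
    rw [eval_nil] at hE
    subst hE
    exact ⟨rfl, rfl, 0, eval_nil.2 rfl⟩
  | 0, _, _ :: _, hE, _ => absurd hE (not_eval_zero (by simp))
  | k + 1, ν, x :: q, hE, hq => by
    obtain ⟨e, rfl⟩ := Nat.exists_eq_add_of_le' (hq x (by simp))
    have hadd : Addable (squash c ν) (e + 2) ↔ Addable ν (e + 3) := by
      rw [addable_succ, addable_succ]
      simp [squash]
    rw [List.map_cons, show e + 3 - 1 = e + 2 from rfl]
    by_cases he : Addable ν (e + 3)
    · obtain ⟨h1, h2, h3⟩ := outcome_squash c k _ q ((eval_accept he).1 hE)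
        fun x hx => hq x (by simp [hx])
      rw [outcome_accept (hadd.2 he), ← squash_grow]
      refine ⟨h1.trans ?_, h2.trans ?_, h3⟩ <;> simp [grow_apply]
    · obtain ⟨h1, h2, h3⟩ := outcome_squash c k _ _ ((eval_reject he).1 hE) fun x hx => by
        rcases List.mem_append.1 hx with hx | hx
        · exact hq x (by simp [hx])
        · rw [List.mem_singleton] at hx; omega
      rw [outcome_reject (mt hadd.1 he)]
      refine ⟨h1, h2, ?_⟩
      simpa using h3

/-- The comparison of catabolism insertion before and after a catabolism, from the time on when the
labels `0` have been accepted into the first row. If this row is removed, its labels are put back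
behind the block `A` of labels that have not been visited yet, and all other labels are decreased
by one, then the insertion runs in parallel, and in the end the first two rows are merged. By the
last hypothesis, all labels `1` of `A` fit into the second row without making it longer than the
first. -/
theorem outcome_catabolism {μ : ℕ → ℕ} : ∀ (k : ℕ) (ν : ℕ → ℕ) (A C : List ℕ), Eval μ k ν (A ++ C) →
    (∀ x ∈ A, 1 ≤ x) → (∀ x ∈ C, 3 ≤ x) → ν 1 + A.count 1 ≤ ν 0 → μ 0 = ν 0 ∧
      Outcome (squash (ν 1) ν) (A.map (· - 1) ++ (List.replicate (ν 0) 0 ++ C.map (· - 1)))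
        (squash (μ 0 + μ 1) μ)
  | k, ν, [], C, hE, _, hC, _ => by
    obtain ⟨h1, h2, h3⟩ := outcome_squash (ν 0 + ν 1) k ν C hE hC
    refine ⟨h1, ?_⟩
    rw [List.map_nil, List.nil_append, outcome_replicate_append, h1, h2]
    have : (fun i => if i = 0 then squash (ν 1) ν 0 + ν 0 else squash (ν 1) ν i) =
        squash (ν 0 + ν 1) ν := by
      funext i
      simp only [squash]
      split_ifs
      · exact add_comm _ _
      · rfl
    rwa [this]
  | 0, _, _ :: _, _, hE, _, _, _ => absurd hE (not_eval_zero (by simp))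
  | k + 1, ν, a :: A, C, hE, hA, hC, hc => by
    obtain ⟨e, rfl⟩ := Nat.exists_eq_add_of_le' (hA a (by simp))
    have hA' : ∀ x ∈ A, 1 ≤ x := fun x hx => hA x (by simp [hx])
    rw [List.count_cons] at hc
    rw [List.cons_append] at hE
    rw [List.map_cons, List.cons_append, Nat.add_sub_cancel]
    match e, hE, hc with
    | 0, hE, hc =>
      rw [if_pos (by simp)] at hc
      have he : Addable ν 1 := Or.inr (by show ν 1 < ν 0; omega)
      obtain ⟨h1, h2⟩ := outcome_catabolism k _ A C ((eval_accept he).1 hE) hA' hC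
        (by simp only [grow_apply]; simp; omega)
      rw [outcome_accept (Or.inl rfl)]
      have h3 : grow ν 1 0 = ν 0 := by simp [grow_apply]
      have h4 : squash (grow ν 1 1) (grow ν 1) = grow (squash (ν 1) ν) 0 := by
        funext i
        simp only [squash, grow_apply]
        by_cases hi : i = 0
        · simp [hi]
        · simp [hi]
      rw [h3, h4] at h2
      exact ⟨h1.trans h3, h2⟩
    | e + 1, hE, hc =>
      rw [if_neg (by simp)] at hc
      have hadd : Addable (squash (ν 1) ν) (e + 1) ↔ Addable ν (e + 1 + 1) := by
        rw [addable_succ, addable_succ]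
        simp only [squash]
        by_cases he : e = 0
        · simp [he]
        · simp [he]
      by_cases he : Addable ν (e + 1 + 1)
      · have h3 : grow ν (e + 1 + 1) 0 = ν 0 := by simp [grow_apply]
        have h4 : grow ν (e + 1 + 1) 1 = ν 1 := by simp [grow_apply]
        obtain ⟨h1, h2⟩ := outcome_catabolism k _ A C ((eval_accept he).1 hE) hA' hC
          (by rw [h3, h4]; omega)
        rw [outcome_accept (hadd.2 he), ← squash_grow]
        rw [h3, h4] at h2
        exact ⟨h1.trans h3, h2⟩
      · have hE' := (eval_reject he).1 hE
        rw [List.append_assoc] at hE'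
        obtain ⟨h1, h2⟩ := outcome_catabolism k ν A (C ++ [e + 1 + 1 + 1]) hE' hA'
          (fun x hx => by
            rcases List.mem_append.1 hx with hx | hx
            · exact hC x hx
            · rw [List.mem_singleton] at hx; omega) (by omega)
        rw [outcome_reject (mt hadd.1 he)]
        refine ⟨h1, ?_⟩
        simpa using h2

/-- Catabolism insertion for the labels `V` followed by `0, …, 0` and `ρ`, and for the word in
which these two factors are exchanged and `V` is decreased by one. -/
theorem outcome_rotate {μ : ℕ → ℕ} {d : ℕ} {V ρ : List ℕ} (hV : ∀ x ∈ V, 1 ≤ x)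
    (hρ : ∀ x ∈ ρ, 1 ≤ x) (hd : V.count 1 ≤ d)
    (h : Outcome (fun _ => 0) (V ++ (List.replicate d 0 ++ ρ)).reverse μ) :
    μ 0 = d ∧ Outcome (fun _ => 0) ((List.replicate d 0 ++ ρ) ++ V.map (· - 1)).reverse
      (squash (μ 0 + μ 1) μ) := by
  rw [List.reverse_append, List.reverse_append, List.reverse_replicate, List.append_assoc,
    outcome_zero_append _ _ (fun x hx => hρ x (List.mem_reverse.1 hx)), List.append_assoc,
    outcome_replicate_append] at h
  obtain ⟨k, hk⟩ := h
  have h0 : ∀ x ∈ ρ.reverse.map (· + 1), 2 ≤ x := fun x hx => by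
    rw [List.mem_map] at hx
    obtain ⟨y, hy, rfl⟩ := hx
    have := hρ y (List.mem_reverse.1 hy)
    omega
  obtain ⟨h1, h2⟩ := outcome_catabolism k (fun i => if i = 0 then 0 + d else 0)
    (V.reverse ++ ρ.reverse.map (· + 1)) [] (by simpa using hk)
    (fun x hx => by
      rcases List.mem_append.1 hx with hx | hx
      · exact hV x (List.mem_reverse.1 hx)
      · have := h0 x hx; omega)
    (by simp)
    (by
      have hz : (ρ.reverse.map (· + 1)).count 1 = 0 :=
        List.count_eq_zero_of_not_mem fun hx => by have := h0 1 hx; omega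
      rw [List.count_append, List.count_reverse, hz]
      simpa using hd)
  refine ⟨by simpa using h1, ?_⟩
  have h3 : squash ((fun i => if i = 0 then 0 + d else 0) 1) (fun i => if i = 0 then 0 + d else 0) =
      fun _ => 0 := by
    funext i
    simp [squash]
  rw [h3] at h2
  simpa [Function.comp_def] using h2

/-- An entry of a tableau above the first row has a smaller entry below it. -/
theorem exists_lt_below {R : ℕ → ℕ → Prop} : ∀ (T : List (List ℕ)) (s : List ℕ),
    (s :: T).IsChain ColumnStrict → (readingWord (s :: T)).Pairwise R → ∀ g ∈ readingWord T,
    ∃ g' ∈ readingWord (s :: T), g' < g ∧ R g g'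
  | [], _, _, _, g, hg => by simp [readingWord] at hg
  | q :: T, s, hT, hR, g, hg => by
    rw [List.isChain_cons_cons] at hT
    rw [readingWord_cons] at hR ⊢
    rw [List.pairwise_append] at hR
    rcases List.mem_append.1 (readingWord_cons q T ▸ hg) with hg' | hg'
    · obtain ⟨g', h1, h2⟩ := exists_lt_below T q hT.2 hR.1 g hg'
      exact ⟨g', List.mem_append_left _ h1, h2⟩
    · have h1 : 0 < q.countP (fun u => decide (u ≤ g)) :=
        List.countP_pos_iff.2 ⟨g, hg', by simp⟩
      obtain ⟨g', h2, h3⟩ := List.countP_pos_iff.1 (h1.trans_le (hT.1 g))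
      exact ⟨g', List.mem_append_right _ h2, by simpa using h3, hR.2.2 g hg g' h2⟩

section
variable {n : ℕ} {T : List (List ℕ)}

theorem one_mem_firstRow (hT : IsTableau T) (hw : IsStandard n (readingWord T))
    (h1 : 1 ∈ readingWord T) : 1 ∈ firstRow T := by
  rw [← upperWord_append_firstRow] at h1
  rcases List.mem_append.1 h1 with h1 | h1
  · cases T with
    | nil => simp [upperWord] at h1
    | cons r T =>
      obtain ⟨g, hg, hlt, -⟩ := exists_lt_below (R := fun _ _ => True) T r hT.2
        (List.pairwise_of_forall fun _ _ => trivial) 1 h1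
      have := ((hw.2 g).1 hg).1
      omega
  · exact h1

theorem label_pairwise {w : List ℕ} (hw : IsStandard n w) :
    w.Pairwise fun x y => cochargeLabel w x = cochargeLabel w y → x < y := by
  refine pairwise_of_idxOf hw.1 fun x hx y hy hxy hlab => ?_
  by_contra hcon
  have := idxOf_le_of_label_eq ((hw.2 y).1 hy).1 (not_lt.1 hcon) hlab.symm
  omega

theorem one_le_label_upperWord (hT : IsTableau T) (hw : IsStandard n (readingWord T)) {x : ℕ}
    (hx : x ∈ upperWord T) : 1 ≤ cochargeLabel (readingWord T) x := by
  have hw' := hw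
  rw [← upperWord_append_firstRow] at hw'
  have hx' := (hw'.2 x).1 (List.mem_append_left _ hx)
  have := (cochargeLabel_rotate hw' (fun h1 => one_mem_firstRow hT hw
    (upperWord_append_firstRow T ▸ h1)) x hx'.1 hx'.2).2 hx
  rw [upperWord_append_firstRow] at this
  omega

/-- The letters with label `1` that are not in the first row are all in the second row, and by
column strictness there are at most as many of them as letters with label `0`. -/
theorem count_one_le (hT : IsTableau T) (hw : IsStandard n (readingWord T)) :
    ((upperWord T).map (cochargeLabel (readingWord T))).count 1 ≤
      ((firstRow T).map (cochargeLabel (readingWord T))).count 0 := by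
  have hpos := fun x => one_le_label_upperWord hT hw (x := x)
  have hpair := label_pairwise hw
  set f := cochargeLabel (readingWord T) with hf
  have hmono : Monotone f := monotone_cochargeLabel _
  simp only [List.count, List.countP_map]
  match T, hT, hpos, hpair with
  | [], _, _, _ => simp [upperWord]
  | [r], _, _, _ => simp [upperWord]
  | r :: s :: T, hT, hpos, hpair =>
    have hup : upperWord (r :: s :: T) = readingWord T ++ s := by simp [upperWord, readingWord]
    rw [hup] at hpos ⊢
    rw [readingWord_cons, List.pairwise_append] at hpair
    have hch := List.isChain_cons_cons.1 hT.2
    have hzero : (readingWord T).countP ((fun x => x == 1) ∘ f) = 0 := by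
      rw [List.countP_eq_zero]
      intro g hg hg1
      have hg1 : f g = 1 := by simpa using hg1
      obtain ⟨g', h1, h2, h3⟩ := exists_lt_below T s hch.2 hpair.1 g hg
      have h4 := hmono h2.le
      have h5 := hpos g' (by rwa [readingWord_cons] at h1)
      have := h3 (by omega)
      omega
    rw [List.countP_append, hzero, zero_add]
    by_cases hne : ∃ x ∈ s, f x = 1
    · have hne' : (s.toFinset.filter fun x => f x = 1).Nonempty := by
        obtain ⟨x, hx, hx1⟩ := hne
        exact ⟨x, by simp [hx, hx1]⟩
      -- `t` is the largest letter with label `1` in the second row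
      obtain ⟨t, ht, hmax⟩ := Finset.exists_max_image _ id hne'
      simp only [Finset.mem_filter, List.mem_toFinset, id] at ht hmax
      calc s.countP ((fun x => x == 1) ∘ f)
          ≤ s.countP (fun u => decide (u ≤ t)) := List.countP_mono_left fun u hu hu1 => by
            simpa using hmax u ⟨hu, by simpa using hu1⟩
        _ ≤ r.countP (fun u => decide (u < t)) := hch.1 t
        _ ≤ r.countP ((fun x => x == 0) ∘ f) := List.countP_mono_left fun u hu hut => by
            have hut : u < t := by simpa using hut
            have h1 := hmono hut.le
            have h2 := hpair.2.2 t (by rw [readingWord_cons]; exact List.mem_append_right _ ht.1)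
              u hu
            have : f u = 0 := by
              by_contra h3
              have := h2 (by omega)
              omega
            simpa using this
    · have : s.countP ((fun x => x == 1) ∘ f) = 0 := by
        rw [List.countP_eq_zero]
        intro x hx hx1
        exact hne ⟨x, hx, by simpa using hx1⟩
      rw [this]
      exact Nat.zero_le _

theorem firstRow_pairwise (hT : IsTableau T) : (firstRow T).Pairwise (· < ·) := by
  cases T with
  | nil => simp [firstRow]
  | cons r T => exact hT.1 r (by simp)

/-- The statistic `d(T)` is the number of letters with label `0`. -/
theorem d_eq_count (hT : IsTableau T) (hw : IsStandard n (readingWord T)) :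
    d T = ((firstRow T).map (cochargeLabel (readingWord T))).count 0 := by
  have hpos := fun x => one_le_label_upperWord hT hw (x := x)
  have hr := firstRow_pairwise hT
  set f := cochargeLabel (readingWord T) with hf
  have hmono : Monotone f := monotone_cochargeLabel _
  have hmem : ∀ x, x ∈ upperWord T ∨ x ∈ firstRow T ↔ 1 ≤ x ∧ x ≤ n := fun x => by
    rw [← List.mem_append, upperWord_append_firstRow]; exact hw.2 x
  have hrn : (firstRow T).Nodup := hr.imp ne_of_lt
  have hcount : ((firstRow T).map f).count 0 =
      ((firstRow T).toFinset.filter fun x => f x = 0).card := by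
    have : ((firstRow T).toFinset.filter fun x => f x = 0) =
        ((firstRow T).filter fun x => f x == 0).toFinset := by
      ext x; simp
    rw [this, List.toFinset_card_of_nodup (hrn.filter _), ← List.countP_eq_length_filter,
      List.count, List.countP_map]
    rfl
  rw [hcount, d, Nat.findGreatest_eq_iff]
  refine ⟨?_, fun _ i hi => ?_, fun k hk _ hall => ?_⟩
  · exact (Finset.card_filter_le _ _).trans (List.toFinset_card_le _)
  · by_contra hir
    have hsub : ((firstRow T).toFinset.filter fun x => f x = 0) ⊆ Finset.Icc 1 i := fun z hz => by
      simp only [Finset.mem_filter, List.mem_toFinset] at hz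
      have hz' := (hmem z).1 (Or.inr hz.1)
      rw [Finset.mem_Icc]
      refine ⟨hz'.1, ?_⟩
      by_contra hzi
      have hzne : z ≠ i + 1 := fun h => hir (h ▸ hz.1)
      rcases (hmem (i + 1)).2 ⟨by omega, by omega⟩ with h | h
      · have h1 := hpos _ h
        have h2 : f (i + 1) ≤ f z := hmono (by omega)
        omega
      · exact hir h
    have := Finset.card_le_card hsub
    rw [Nat.card_Icc] at this
    omega
  · have hlab : ∀ i < k, f (i + 1) = 0 := by
      intro i
      induction i with
      | zero => intro _; rfl
      | succ i ih =>
        intro hi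
        have h1 := hall i (by omega)
        have h2 := hall (i + 1) hi
        have h3 := idxOf_lt_of_pairwise hr h1 h2 (by omega)
        have hup : ∀ x ∈ firstRow T, x ∉ upperWord T := fun x hx hx' => by
          have := hw.1
          rw [← upperWord_append_firstRow, List.nodup_append] at this
          exact this.2.2 x hx' x hx rfl
        rw [hf, cochargeLabel_succ _ (by omega), ← hf, ih (by omega), zero_add, if_neg]
        rw [← upperWord_append_firstRow, List.idxOf_append_of_notMem (hup _ h1),
          List.idxOf_append_of_notMem (hup _ h2)]
        omega
    have hsub : Finset.Icc 1 k ⊆ ((firstRow T).toFinset.filter fun x => f x = 0) := fun z hz => by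
      rw [Finset.mem_Icc] at hz
      obtain ⟨i, rfl⟩ := Nat.exists_eq_add_of_le' hz.1
      simp only [Finset.mem_filter, List.mem_toFinset]
      exact ⟨hall i (by omega), hlab i (by omega)⟩
    have := Finset.card_le_card hsub
    rw [Nat.card_Icc] at this
    omega

theorem eq_replicate_append_filter : ∀ {l : List ℕ}, l.Pairwise (· ≤ ·) →
    l = List.replicate (l.count 0) 0 ++ l.filter (fun x => decide (1 ≤ x))
  | [], _ => by simp
  | a :: l, h => by
    rw [List.pairwise_cons] at h
    rcases Nat.eq_zero_or_pos a with rfl | ha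
    · have ih := eq_replicate_append_filter h.2
      rw [List.count_cons_self, List.replicate_succ, List.filter_cons_of_neg (by simp),
        List.cons_append, ← ih]
    · have h0 : ∀ x ∈ a :: l, 1 ≤ x := fun x hx => by
        rcases List.mem_cons.1 hx with rfl | hx
        · exact ha
        · exact ha.trans_le (h.1 x hx)
      rw [List.count_eq_zero_of_not_mem fun h' => by have := h0 0 h'; omega,
        List.filter_eq_self.2 fun x hx => by simpa using h0 x hx]
      rfl

/-- One catabolism merges the first two rows of the outcome of catabolism insertion. -/
theorem outcome_K {μ : ℕ → ℕ} (hT : IsTableau T) (hw : IsStandard n (readingWord T))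
    (h : Outcome (fun _ => 0) (cochargeWord (readingWord T)).reverse μ) :
    d T = μ 0 ∧ IsStandard n (firstRow T ++ upperWord T) ∧
      Outcome (fun _ => 0) (cochargeWord (firstRow T ++ upperWord T)).reverse
        (squash (μ 0 + μ 1) μ) := by
  have hpos := fun x => one_le_label_upperWord hT hw (x := x)
  have hw' := hw
  rw [← upperWord_append_firstRow] at hw'
  have hrot := cochargeLabel_rotate hw' (fun h1 => one_mem_firstRow hT hw
    (upperWord_append_firstRow T ▸ h1))
  have hd := d_eq_count hT hw
  have hcount := count_one_le hT hw
  rw [← hd] at hcount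
  have hsorted : ((firstRow T).map (cochargeLabel (readingWord T))).Pairwise (· ≤ ·) := by
    rw [List.pairwise_map]
    exact (firstRow_pairwise hT).imp fun hxy => monotone_cochargeLabel _ hxy.le
  have hsplit := eq_replicate_append_filter hsorted
  rw [← hd] at hsplit
  have h1 : cochargeWord (readingWord T) = (upperWord T).map (cochargeLabel (readingWord T)) ++
      (firstRow T).map (cochargeLabel (readingWord T)) := by
    rw [← List.map_append, upperWord_append_firstRow]
    rfl
  have h2 : cochargeWord (firstRow T ++ upperWord T) =
      (firstRow T).map (cochargeLabel (readingWord T)) ++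
        ((upperWord T).map (cochargeLabel (readingWord T))).map (· - 1) := by
    rw [upperWord_append_firstRow] at hrot
    rw [cochargeWord, List.map_append, List.map_map]
    congr 1
    · refine List.map_congr_left fun x hx => ?_
      have hx' := (hw'.2 x).1 (List.mem_append_right _ hx)
      exact (hrot x hx'.1 hx'.2).1 hx
    · refine List.map_congr_left fun x hx => ?_
      have hx' := (hw'.2 x).1 (List.mem_append_left _ hx)
      have := (hrot x hx'.1 hx'.2).2 hx
      simp only [Function.comp_apply]
      omega
  rw [h1, hsplit] at h
  obtain ⟨h3, h4⟩ := outcome_rotate (fun x hx => by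
      rw [List.mem_map] at hx
      obtain ⟨y, hy, rfl⟩ := hx
      exact hpos y hy)
    (fun x hx => by simpa using (List.mem_filter.1 hx).2) hcount h
  rw [← hsplit, ← h2] at h4
  exact ⟨h3.symm, hw'.perm List.perm_append_comm, h4⟩

end

theorem d_iterate_K {n : ℕ} : ∀ (i : ℕ) (w : List ℕ) (μ : ℕ → ℕ), IsStandard n w →
    Outcome (fun _ => 0) (cochargeWord w).reverse μ →
    d (K^[i] (P w)) = ∑ a ∈ Finset.range (i + 1), μ a
  | i, w, μ, hw, h => by
    obtain ⟨hT, hK⟩ := P_spec w hw.1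
    have hw' := hw.perm hK.perm
    have h' : Outcome (fun _ => 0) (cochargeWord (readingWord (P w))).reverse μ := by
      obtain ⟨k, hk⟩ := h
      exact ⟨k, (hK.eval_iff hw.1 fun x hx => ((hw.2 x).1 hx).1).1 hk⟩
    obtain ⟨h1, h2, h3⟩ := outcome_K hT hw' h'
    match i with
    | 0 => simpa using h1
    | i + 1 =>
      rw [Function.iterate_succ_apply, K, d_iterate_K i _ _ h2 h3, Finset.sum_range_succ' _ i,
        Finset.sum_range_succ' _ (i + 1), Finset.sum_range_succ' _ i]
      simp only [squash, if_true, Nat.add_eq_zero_iff, one_ne_zero, and_false, if_false]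
      ring

/-- The catabolizability type of the insertion tableau of a word is the outcome of catabolism
insertion for its cocharge word. -/
theorem ctypeTab_P {n : ℕ} {w : List ℕ} {μ : ℕ → ℕ} (hw : IsStandard n w)
    (h : Outcome (fun _ => 0) (cochargeWord w).reverse μ) : ctypeTab (P w) = μ := by
  funext i
  cases i with
  | zero =>
    have := d_iterate_K 0 w μ hw h
    simpa [ctypeTab] using this
  | succ i =>
    rw [ctypeTab, d_iterate_K _ w μ hw h, d_iterate_K _ w μ hw h, Finset.sum_range_succ _ (i + 1)]
    exact Nat.add_sub_cancel_left _ _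

/-! ### Dominance -/

theorem isStandard_oneLine {n : ℕ} (w : Equiv.Perm (Fin n)) : IsStandard n (oneLine w) := by
  refine ⟨?_, fun x => ?_⟩
  · rw [oneLine, List.nodup_ofFn]
    intro i j hij
    exact w.injective (Fin.ext (by simpa using hij))
  · rw [oneLine, List.mem_ofFn]
    constructor
    · rintro ⟨i, rfl⟩
      omega
    · rintro ⟨h1, h2⟩
      exact ⟨w.symm ⟨x - 1, by omega⟩, by simp; omega⟩

theorem length_cc {n : ℕ} (w : Equiv.Perm (Fin n)) : (cc w).length = n := by simp [cc, oneLine]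

/-- Letters with their positions as visiting times form a queue. -/
theorem isQueue_zipIdx {α : Type*} (f : α → ℕ) (q : List α) :
    IsQueue ((q.length : ℤ) + 1) 0 (q.zipIdx.map fun x => ((x.2 : ℤ), f x.1)) := by
  constructor
  · rw [List.pairwise_map, List.pairwise_iff_getElem]
    intro i j hi hj hij
    simp only [List.getElem_zipIdx]
    push_cast
    omega
  · intro x hx
    rw [List.mem_map] at hx
    obtain ⟨⟨a, i⟩, h, rfl⟩ := hx
    have := List.snd_lt_of_mem_zipIdx h
    simp only
    omega

theorem exists_outcome {n : ℕ} {w : List ℕ} (hw : IsStandard n w) :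
    ∃ μ, Outcome (fun _ => 0) (cochargeWord w).reverse μ := by
  have hL := isQueue_zipIdx (cochargeLabel w) w.reverse
  set L := w.reverse.zipIdx.map fun x => ((x.2 : ℤ), cochargeLabel w x.1) with hLdef
  have hsnd : L.map Prod.snd = (cochargeWord w).reverse := by
    rw [hLdef, List.map_map, cochargeWord, ← List.map_reverse]
    conv_rhs => rw [← List.zipIdx_map_fst 0 w.reverse, List.map_map]
    rfl
  obtain ⟨k, μ, hk⟩ := exists_eval L.length L (fun _ => 0) 0 0 rfl (by simp) hL (by
    intro y hy hy0
    obtain ⟨x, hx, rfl⟩ := mem_anchors.1 hy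
    rw [hLdef, List.mem_map] at hx
    obtain ⟨⟨x, i⟩, hx, rfl⟩ := hx
    rw [List.mk_mem_zipIdx_iff_getElem?, List.getElem?_eq_some_iff] at hx
    obtain ⟨hi, hx⟩ := hx
    have hxw : x ∈ w := List.mem_reverse.1 (hx ▸ List.getElem_mem hi)
    have hx1 := (hw.2 x).1 hxw
    simp only [anchor] at hy0 ⊢
    -- a letter with positive label is covered by its predecessor
    obtain ⟨x', rfl⟩ := Nat.exists_eq_add_of_le' hx1.1
    have hx' : 1 ≤ x' := by
      rcases Nat.eq_zero_or_pos x' with rfl | h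
      · simp [cochargeLabel] at hy0
        omega
      · exact h
    have hxw' : x' ∈ w.reverse := List.mem_reverse.2 ((hw.2 x').2 ⟨hx', by omega⟩)
    obtain ⟨i', hi', hxi'⟩ := List.getElem_of_mem hxw'
    refine ⟨(i' : ℤ) - (w.reverse.length + 1) * cochargeLabel w x', mem_anchors.2
      ⟨((i' : ℤ), cochargeLabel w x'), ?_, rfl⟩, ?_⟩
    · rw [hLdef, List.mem_map]
      exact ⟨(x', i'), List.mk_mem_zipIdx_iff_getElem?.2 (List.getElem?_eq_some_iff.2 ⟨hi', hxi'⟩),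
        rfl⟩
    · have h1 : w.idxOf (x' + 1) = w.length - 1 - i := by
        rw [← hx, List.getElem_reverse, hw.1.idxOf_getElem]
      have h2 : w.idxOf x' = w.length - 1 - i' := by
        rw [← hxi', List.getElem_reverse, hw.1.idxOf_getElem]
      have hne : i ≠ i' := by
        rintro rfl
        rw [hx] at hxi'
        omega
      rw [cochargeLabel_succ w hx', h1, h2]
      rw [List.length_reverse] at hi hi' ⊢
      split_ifs with h
      · have hlt : (i' : ℤ) < i := by omega
        have hi2 : (i : ℤ) < w.length := by exact_mod_cast hi
        push_cast
        constructor <;> nlinarith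
      · have hlt : (i : ℤ) < i' := by omega
        have hi2 : (i' : ℤ) < w.length := by exact_mod_cast hi'
        push_cast
        constructor <;> nlinarith)
  exact ⟨μ, k, hsnd ▸ hk⟩

theorem outcome_ctype {n : ℕ} (w : Equiv.Perm (Fin n)) :
    Outcome (fun _ => 0) (cc w).reverse (ctype w) := by
  obtain ⟨μ, hμ⟩ := exists_outcome (isStandard_oneLine w)
  have : ctype w = μ := ctypeTab_P (isStandard_oneLine w) hμ
  rw [this]
  exact hμ

theorem card_anchors {N : ℤ} : ∀ {L : List (ℤ × ℕ)} {t : ℤ}, IsQueue N t L →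
    (anchors N L).card = L.length
  | [], _, _ => rfl
  | (T, e) :: L, _, hL => by
    rw [anchors_cons, Finset.card_insert_of_notMem hL.anchor_notMem, card_anchors hL.accept,
      List.length_cons]

/-- The outcome of catabolism insertion from the empty shape, as the shape whose columns are the
lengths of covered chains into which the queue is divided. -/
theorem Outcome.exists_chains {N : ℕ} (hN : 0 < N) {L : List (ℤ × ℕ)} {μ : ℕ → ℕ}
    (h : Outcome (fun _ => 0) (L.map Prod.snd) μ) (hL : IsQueue N 0 L) (hlen : L.length ≤ N) :
    ∃ κ : ℤ → Fin N, (∀ j, Covered N (colourClass (anchors N L) κ j) 0) ∧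
      ∀ a, μ a = (Finset.univ.filter fun j => a < (colourClass (anchors N L) κ j).card).card := by
  have : Nonempty (Fin N) := ⟨⟨0, hN⟩⟩
  obtain ⟨k, hk⟩ := h
  obtain ⟨κ, h1, h2⟩ := Catabolism.exists_chains (ι := Fin N) k L (fun _ => 0) 0 (fun _ => 0) hk hL
    (by simp)
    (by
      simp only [Finset.filter_true, Finset.card_univ, Fintype.card_fin]
      refine List.count_le_length.trans ?_
      rwa [List.length_map])
  exact ⟨κ, by simpa using h1, by simpa using h2⟩

/-- The catabolizability type of a permutation is a partition, with at most `n` parts. -/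
theorem ctype_isPartition {n : ℕ} (w : Equiv.Perm (Fin n)) : Antitone (ctype w) ∧
    ∀ K, n ≤ K → (∀ i, K ≤ i → ctype w i = 0) ∧ ∑ i ∈ Finset.range K, ctype w i = n := by
  have hL := isQueue_zipIdx id (cc w).reverse
  set L := (cc w).reverse.zipIdx.map fun x => ((x.2 : ℤ), id x.1) with hLdef
  have hlen : L.length = n := by simp [hLdef, length_cc]
  have hsnd : L.map Prod.snd = (cc w).reverse := by
    rw [hLdef, List.map_map]
    conv_rhs => rw [← List.zipIdx_map_fst 0 (cc w).reverse]
    rfl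
  rw [List.length_reverse, length_cc] at hL
  obtain ⟨κ, -, hμ⟩ := Outcome.exists_chains (N := n + 1) (by omega) (L := L) (μ := ctype w)
    (by rw [hsnd]; exact outcome_ctype w) (by exact_mod_cast hL) (by omega)
  have hcard := card_anchors hL
  have hle : ∀ j, (colourClass (anchors ((n + 1 : ℕ) : ℤ) L) κ j).card ≤ n := fun j => by
    refine (Finset.card_filter_le _ _).trans ?_
    push_cast
    rw [hcard, hlen]
  refine ⟨fun a b hab => ?_, fun K hK => ⟨fun i hi => ?_, ?_⟩⟩
  · rw [hμ, hμ]
    refine Finset.card_le_card fun j hj => ?_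
    simp only [Finset.mem_filter, Finset.mem_univ, true_and] at hj ⊢
    omega
  · rw [hμ, Finset.card_eq_zero, Finset.filter_eq_empty_iff]
    intro j _
    have := hle j
    omega
  · simp only [hμ]
    rw [sum_card_lt_eq]
    have h1 : ∀ j, min K (colourClass (anchors ((n + 1 : ℕ) : ℤ) L) κ j).card =
        (colourClass (anchors ((n + 1 : ℕ) : ℤ) L) κ j).card := fun j =>
      min_eq_right ((hle j).trans hK)
    simp only [h1]
    have h2 := Finset.card_eq_sum_card_fiberwise (f := κ) (s := anchors ((n + 1 : ℕ) : ℤ) L)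
      (t := Finset.univ) (fun _ _ => Finset.mem_coe.2 (Finset.mem_univ _))
    push_cast at h2 ⊢
    rw [hcard, hlen] at h2
    exact h2.symm

theorem length_eq_sum_filter {l : ℕ} : ∀ p : List (Fin l × ℕ),
    p.length = ∑ j, (p.filter fun a => a.1 = j).length
  | [] => by simp
  | a :: p => by
    have : ∀ j, ((a :: p).filter fun a => a.1 = j).length =
        (p.filter fun a => a.1 = j).length + if a.1 = j then 1 else 0 := fun j => by
      rw [List.filter_cons]
      by_cases h : a.1 = j <;> simp [h]
    simp only [this, Finset.sum_add_distrib, Finset.sum_ite_eq, Finset.mem_univ, if_true]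
    rw [List.length_cons, length_eq_sum_filter p]

/-- The inequalities of the dominance order: the chains of all the words of a shuffle are chains
of the shuffled word. -/
theorem sum_ctype_le {l n : ℕ} {m : Fin l → ℕ} (u : (j : Fin l) → Equiv.Perm (Fin (m j)))
    (w : Equiv.Perm (Fin n)) (hw : IsShuffle (fun j => cc (u j)) (cc w)) (k : ℕ) :
    ∑ i ∈ Finset.range k, ∑ j, ctype (u j) i ≤ ∑ i ∈ Finset.range k, ctype w i := by
  classical
  obtain ⟨p, hp, hpj⟩ := hw
  have hplen : p.length = n := by
    rw [← length_cc w, ← hp, List.length_map]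
  -- the letters with their positions in the queue
  set Q := p.reverse.zipIdx with hQ
  let g : (Fin l × ℕ) × ℕ → ℤ × ℕ := fun x => ((x.2 : ℤ), x.1.2)
  set L := Q.map g with hLdef
  let Lj : Fin l → List (ℤ × ℕ) := fun j => (Q.filter fun x => x.1.1 = j).map g
  have hL : IsQueue ((n + 1 : ℕ) : ℤ) 0 L := by
    have := isQueue_zipIdx (fun x : Fin l × ℕ => x.2) p.reverse
    rw [List.length_reverse, hplen] at this
    exact_mod_cast this
  have hLj : ∀ j, IsQueue ((n + 1 : ℕ) : ℤ) 0 (Lj j) := fun j => by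
    have hsub : List.Sublist (Lj j) L := List.filter_sublist.map g
    exact ⟨hL.1.sublist hsub, fun x hx => hL.2 x (hsub.subset hx)⟩
  have hfst : Q.map Prod.fst = p.reverse := List.zipIdx_map_fst 0 _
  have hsnd : L.map Prod.snd = (cc w).reverse := by
    rw [← hp, ← List.map_reverse, ← hfst, hLdef, List.map_map, List.map_map]
    rfl
  have hsndj : ∀ j, (Lj j).map Prod.snd = (cc (u j)).reverse := fun j => by
    have hpj : (p.filter fun a => a.1 = j).map Prod.snd = cc (u j) := hpj j
    rw [← hpj, ← List.map_reverse, ← List.filter_reverse, ← hfst, List.filter_map, List.map_map,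
      List.map_map]
    rfl
  have hLlen : L.length = n := by simp [hLdef, hQ, hplen]
  have hLjlen : ∀ j, (Lj j).length ≤ n + 1 := fun j => by
    have h1 : (Lj j).length ≤ L.length := (List.filter_sublist.map g).length_le
    omega
  have hchains := fun j => Outcome.exists_chains (N := n + 1) (by omega) (L := Lj j)
    (μ := ctype (u j)) (by rw [hsndj]; exact outcome_ctype (u j)) (hLj j) (hLjlen j)
  choose κ hκ hμ using hchains
  -- an anchor determines the colour of its letter
  have hinj : ∀ x ∈ Q, ∀ y ∈ Q, anchor ((n + 1 : ℕ) : ℤ) (g x) = anchor ((n + 1 : ℕ) : ℤ) (g y) →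
      x = y := by
    have hmap : (Q.map fun x => anchor ((n + 1 : ℕ) : ℤ) (g x)).Nodup := by
      have h1 := card_anchors hL
      rw [anchors, ← List.length_map (f := anchor ((n + 1 : ℕ) : ℤ)), hLdef, List.map_map] at h1
      exact (Multiset.coe_nodup.1 (Multiset.toFinset_card_eq_card_iff_nodup.1 h1))
    intro x hx y hy hxy
    exact List.inj_on_of_nodup_map hmap hx hy hxy
  let col : ℤ → Option (Fin l) := fun y =>
    if h : ∃ x ∈ Q, anchor ((n + 1 : ℕ) : ℤ) (g x) = y then some h.choose.1.1 else none
  have hcol : ∀ x ∈ Q, col (anchor ((n + 1 : ℕ) : ℤ) (g x)) = some x.1.1 := fun x hx => by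
    have hex : ∃ x' ∈ Q, anchor ((n + 1 : ℕ) : ℤ) (g x') = anchor ((n + 1 : ℕ) : ℤ) (g x) :=
      ⟨x, hx, rfl⟩
    simp only [col, dif_pos hex]
    rw [hinj _ hex.choose_spec.1 _ hx hex.choose_spec.2]
  let K : ℤ → Option (Fin l) × Fin (n + 1) := fun y =>
    (col y, match col y with
      | none => 0
      | some j => κ j y)
  have hclass : ∀ j c, colourClass (anchors ((n + 1 : ℕ) : ℤ) L) K (some j, c) =
      colourClass (anchors ((n + 1 : ℕ) : ℤ) (Lj j)) (κ j) c := fun j c => by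
    ext y
    rw [mem_colourClass, mem_colourClass, mem_anchors, mem_anchors]
    constructor
    · rintro ⟨⟨_, hx, rfl⟩, hK⟩
      rw [hLdef, List.mem_map] at hx
      obtain ⟨x, hx, rfl⟩ := hx
      simp only [K, hcol x hx, Prod.mk.injEq, Option.some.injEq] at hK
      obtain ⟨hj, hc⟩ := hK
      subst hj
      exact ⟨⟨g x, List.mem_map_of_mem (List.mem_filter.2 ⟨hx, by simp⟩), rfl⟩, hc⟩
    · rintro ⟨⟨_, hx, rfl⟩, hc⟩
      rw [List.mem_map] at hx
      obtain ⟨x, hx, rfl⟩ := hx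
      obtain ⟨hx, hxj⟩ := List.mem_filter.1 hx
      have hxj : x.1.1 = j := by simpa using hxj
      refine ⟨⟨g x, List.mem_map_of_mem hx, rfl⟩, ?_⟩
      simp only [K, hcol x hx, hxj, hc]
  have hnone : ∀ c, colourClass (anchors ((n + 1 : ℕ) : ℤ) L) K (none, c) = ∅ := fun c => by
    rw [Finset.eq_empty_iff_forall_notMem]
    intro y hy
    rw [mem_colourClass, mem_anchors] at hy
    obtain ⟨⟨_, hx, rfl⟩, hK⟩ := hy
    rw [hLdef, List.mem_map] at hx
    obtain ⟨x, hx, rfl⟩ := hx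
    simp only [K, hcol x hx, Prod.mk.injEq, reduceCtorEq, false_and] at hK
  obtain ⟨s, hs⟩ := outcome_ctype w
  have key := sum_min_le k s L (fun _ => 0) 0 (fun _ => 0) K (by rw [hsnd]; exact hs) hL (by simp)
    (by
      simp only [Finset.filter_true, Finset.card_univ, Fintype.card_prod, Fintype.card_option,
        Fintype.card_fin]
      refine List.count_le_length.trans ?_
      rw [List.length_map, hLlen]
      nlinarith)
    (by
      rintro ⟨o, c⟩
      cases o with
      | none => rw [hnone]; exact fun y hy => absurd hy (Finset.notMem_empty y)
      | some j =>
        rw [hclass]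
        simpa using hκ j c)
  refine le_trans (le_of_eq ?_) key
  rw [Fintype.sum_prod_type, Fintype.sum_option, Finset.sum_comm]
  simp only [hnone, hclass, hμ, sum_card_lt_eq]
  simp

theorem dominates_of_isShuffle {l n : ℕ} {m : Fin l → ℕ}
    (u : (j : Fin l) → Equiv.Perm (Fin (m j))) (w : Equiv.Perm (Fin n))
    (hw : IsShuffle (fun j => cc (u j)) (cc w)) :
    Dominates n (ctype w) (fun i => ∑ j, ctype (u j) i) := by
  have hsum : ∑ j, m j = n := by
    obtain ⟨p, hp, hpj⟩ := hw
    rw [← length_cc w, ← hp, List.length_map, length_eq_sum_filter]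
    refine Finset.sum_congr rfl fun j _ => ?_
    have hpj : (p.filter fun a => a.1 = j).map Prod.snd = cc (u j) := hpj j
    rw [← length_cc (u j), ← hpj, List.length_map]
  have hm : ∀ j, m j ≤ n := fun j =>
    hsum ▸ Finset.single_le_sum (f := m) (fun _ _ => Nat.zero_le _) (Finset.mem_univ j)
  refine ⟨⟨(ctype_isPartition w).1, n, (ctype_isPartition w).2 n le_rfl⟩,
    ⟨fun a b hab => ?_, n, fun i hi => ?_, ?_⟩, sum_ctype_le u w hw⟩
  · exact Finset.sum_le_sum fun j _ => (ctype_isPartition (u j)).1 hab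
  · exact Finset.sum_eq_zero fun j _ => ((ctype_isPartition (u j)).2 n (hm j)).1 i hi
  · rw [Finset.sum_comm, ← hsum]
    exact Finset.sum_congr rfl fun j _ => hsum ▸ ((ctype_isPartition (u j)).2 n (hm j)).2

end Catabolism

theorem mainTheorem4 {l n : ℕ} {m : Fin l → ℕ}
    (u : (j : Fin l) → Equiv.Perm (Fin (m j))) (w : Equiv.Perm (Fin n))
    (hw : Catabolism.IsShuffle (fun j => Catabolism.cc (u j)) (Catabolism.cc w)) :
    Catabolism.Dominates n (Catabolism.ctype w)
      (fun i => ∑ j, Catabolism.ctype (u j) i) :=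
  Catabolism.dominates_of_isShuffle u w hw
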